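/- Let $R$ be a commutative ring and $f\colon X\to S=\operatorname{Spec}(R)$ a flat morphism between noetherian schemes. Let $E$ be a commutative formal Lie group over $X$, i.e. a sheaf of abelian groups on the big Zariski site of $X$ such that every point of $X$ has an affine open neighbourhood $U=\operatorname{Spec}(B)$ with an isomorphism of $U$-functors $E\times_X U\cong \operatorname{Spf}(B[[x_1,\dots,x_d]])$ (for some $d\ge 0$) under which the zero of $E(U)$ corresponds to $x_i\mapsto 0$ for all $i$. For an $R$-algebra $A$ put $T=\operatorname{Spec}(A)$, $X_A=X\times_S T$, let $\iota\colon X\times_S T_{\mathrm{red}}\to X_A$ be the base change of $T_{\mathrm{red}}\to T$, and let $\tilde E_A=\ker(E\to\iota_*E)$, a sheaf on the small Zariski site of $X_A$; that is, $\tilde E_A(U)=\ker(E(U)\to E(U\times_T T_{\mathrm{red}}))$ for every open $U\subset X_A$. A homomorphism $A\to B$ of $R$-algebras induces, by pullback along $X_B\to X_A$, maps $H^q(X_A,\tilde E_A)\to H^q(X_B,\tilde E_B)$. Let $$N_R(A)=\bigl(R\oplus \operatorname{nil}(A)\bigr)/\{(r,-r) : r\in\operatorname{nil}(R)\},\qquad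 (r,n)(r',n')=(rr',\,rn'+r'n+nn'),$$ where $\operatorname{nil}$ denotes the nilradical; $N_R$ is a functor from $R$-algebras to $R$-algebras, and $(r,n)\mapsto r+n$ is a natural homomorphism $N_R(A)\to A$. Then for every $q\ge 0$ and every noetherian $R$-algebra $A$ the map $$H^q\bigl(X_{N_R(A)},\tilde E_{N_R(A)}\bigr)\longrightarrow H^q\bigl(X_A,\tilde E_A\bigr)$$ induced by $N_R(A)\to A$ is an isomorphism of abelian groups, and it is functorial in $A$: for every homomorphism $A\to B$ of noetherian $R$-algebras, these maps for $A$ and $B$ commute with the maps on cohomology induced by $A\to B$ and by $N_R(A)\to N_R(B)$. -/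

import Mathlib

open CategoryTheory Limits AlgebraicGeometry TopologicalSpace Opposite

universe u

noncomputable section

namespace DeformationCohomology

section NilpotentHull

variable (R : Type u) [CommRing R] (A : Type u) [CommRing A] [Algebra R A]

instance : IsScalarTower R (nilradical A) (nilradical A) :=
  ⟨fun r x y => Subtype.ext (smul_mul_assoc r (x : A) (y : A))⟩

instance : SMulCommClass R (nilradical A) (nilradical A) :=
  ⟨fun r x y => Subtype.ext (mul_smul_comm r (x : A) (y : A)).symm⟩

/-- The ideal `{(r, -r) ; r ∈ nil(R)}` of `R ⊕ nil(A)`. Here `R ⊕ nil(A)` is Mathlib's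
`Unitization`, with product `(r, n) * (r', n') = (r r', r n' + r' n + n n')`. -/
def nilRelations : Ideal (Unitization R (nilradical A)) where
  carrier := {x | x.fst ∈ nilradical R ∧ (x.snd : A) = -algebraMap R A x.fst}
  zero_mem' := by simp
  add_mem' := by
    rintro x y ⟨hx, hx'⟩ ⟨hy, hy'⟩
    refine ⟨by simpa using Ideal.add_mem _ hx hy, ?_⟩
    simp [hx', hy']
    ring
  smul_mem' := by
    rintro c x ⟨hx, hx'⟩
    refine ⟨by simpa using Ideal.mul_mem_left _ _ hx, ?_⟩
    simp [hx', Algebra.smul_def]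
    ring

/-- `N_R(A) = R ⊕ nil(A) / {(r, -r) ; r ∈ nil(R)}`. -/
abbrev NilHull : Type u := Unitization R (nilradical A) ⧸ nilRelations R A

/-- The inclusion `nil(A) → A`. -/
def nilInclusion : nilradical A →ₙₐ[R] A where
  toFun n := n
  map_smul' _ _ := rfl
  map_zero' := rfl
  map_add' _ _ := rfl
  map_mul' _ _ := rfl

/-- The natural map `N_R(A) → A`, `(r, n) ↦ r + n`. -/
def NilHull.toAlgebra : NilHull R A →ₐ[R] A :=
  Ideal.Quotient.liftₐ (nilRelations R A) (Unitization.lift (nilInclusion R A)) (by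
    rintro x ⟨-, hx⟩
    simp [nilInclusion, hx])

variable {R A} {B : Type u} [CommRing B] [Algebra R B]

/-- The map `nil(A) → nil(B)` induced by a homomorphism of `R`-algebras. -/
def nilMap (φ : A →ₐ[R] B) : nilradical A →ₙₐ[R] nilradical B where
  toFun n := ⟨φ n, IsNilpotent.map n.2 φ⟩
  map_smul' _ _ := Subtype.ext (by simp)
  map_zero' := Subtype.ext (by simp)
  map_add' _ _ := Subtype.ext (by simp)
  map_mul' _ _ := Subtype.ext (by simp)

/-- Functoriality of `N_R`: the map `(r, n) ↦ (r, φ n)`. -/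
def NilHull.map (φ : A →ₐ[R] B) : NilHull R A →ₐ[R] NilHull R B :=
  Ideal.quotientMapₐ (nilRelations R B)
    (Unitization.lift ((Unitization.inrNonUnitalAlgHom R (nilradical B)).comp (nilMap φ))) (by
      rintro x ⟨hx, hx'⟩
      refine ⟨by simpa [Unitization.algebraMap_eq_inl] using hx, ?_⟩
      simp [nilMap, hx', Unitization.algebraMap_eq_inl])

/-- The map `A / nil(A) → B / nil(B)` induced by a homomorphism of `R`-algebras. -/
def redMap (φ : A →ₐ[R] B) : (A ⧸ nilradical A) →ₐ[R] (B ⧸ nilradical B) :=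
  Ideal.quotientMapₐ (nilradical B) φ (fun _ hx => IsNilpotent.map hx φ)

end NilpotentHull

section BigZariski

/-- Sheaves of abelian groups on the big Zariski site of `X`. -/
abbrev BigSheaf (X : Scheme.{u}) := Sheaf (Scheme.zariskiTopology.over X) AddCommGrpCat.{u}

/-- Sheaves of abelian groups on the small Zariski site of `X`. -/
abbrev SmallSheaf (X : Scheme.{u}) := Sheaf (Opens.grothendieckTopology X) AddCommGrpCat.{u}

lemma hom_restrictFunctor_ext {Y : Scheme.{u}} {W : Over Y} {U : Y.Opens}
    (f g : W ⟶ Y.restrictFunctor.obj U) : f = g := by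
  apply Over.OverMorphism.ext
  exact (cancel_mono U.ι).1 ((Over.w f).trans (Over.w g).symm)

instance restrictFunctor_isContinuous (Y : Scheme.{u}) :
    Y.restrictFunctor.IsContinuous (Opens.grothendieckTopology Y)
      (Scheme.zariskiTopology.over Y) := by
  refine Functor.isContinuous_of_coverPreserving ⟨?_⟩ ⟨?_⟩
  · intro F Z T x hx Y₁ Y₂ W f₁ f₂ g₁ g₂ hg₁ hg₂ h
    have h₁ : f₁.left ≫ Scheme.Opens.ι Y₁ = W.hom := Over.w f₁
    have h₂ : f₂.left ≫ Scheme.Opens.ι Y₂ = W.hom := Over.w f₂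
    let V : Y.Opens := Y₁ ⊓ Y₂
    let w : W.left ⟶ Y := W.hom
    have hr : Set.range w ⊆ Set.range V.ι := by
      rw [Scheme.Opens.range_ι]
      rintro _ ⟨z, rfl⟩
      refine ⟨?_, ?_⟩
      · rw [show w = _ from h₁.symm]; exact (f₁.left z).2
      · rw [show w = _ from h₂.symm]; exact (f₂.left z).2
    let l : W.left ⟶ V := IsOpenImmersion.lift V.ι w hr
    let k : W ⟶ Y.restrictFunctor.obj V := Over.homMk l (IsOpenImmersion.lift_fac V.ι w hr)
    have e₁ : f₁ = k ≫ Y.restrictFunctor.map (homOfLE inf_le_left : V ⟶ Y₁) :=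
      hom_restrictFunctor_ext _ _
    have e₂ : f₂ = k ≫ Y.restrictFunctor.map (homOfLE inf_le_right : V ⟶ Y₂) :=
      hom_restrictFunctor_ext _ _
    have := hx (homOfLE inf_le_left : V ⟶ Y₁) (homOfLE inf_le_right : V ⟶ Y₂)
      hg₁ hg₂ (Subsingleton.elim _ _)
    rw [e₁, e₂]
    simp only [op_comp, Functor.map_comp, types_comp_apply]
    exact congrArg (F.obj.map k.op) this
  · intro U S hS
    rw [GrothendieckTopology.mem_over_iff, Scheme.mem_grothendieckTopology_iff]
    let U' : Y.Opens := U
    choose V f hf hxV using fun x : U' => hS x.1 x.2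
    let 𝒰 : Scheme.OpenCover.{u} U' :=
      { I₀ := U'
        X := fun x => (V x : Y.Opens)
        f := fun x => Y.homOfLE (f x).le
        mem₀ := by
          rw [Scheme.presieve₀_mem_precoverage_iff]
          refine ⟨fun x => ⟨x, ⟨x.1, hxV x⟩, ?_⟩, fun x => inferInstance⟩
          exact Subtype.ext (by simp) }
    have hw (x : U') : 𝟙 _ ≫ Scheme.Opens.ι (V x) = Y.homOfLE (f x).le ≫ U.ι := by
      rw [Scheme.homOfLE_ι, Category.id_comp]
    refine ⟨𝒰, ?_⟩
    rintro - - ⟨x⟩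
    rw [Sieve.overEquiv_iff]
    exact ⟨V x, f x, Over.homMk (𝟙 _) (hw x), hf x, hom_restrictFunctor_ext _ _⟩

variable {X Y Y' : Scheme.{u}}

/-- The functor sending an open `U` of an `X`-scheme `Y` to the `X`-scheme `U`. -/
abbrev opensOver (p : Y ⟶ X) : Y.Opens ⥤ Over X := Y.restrictFunctor ⋙ Over.map p

instance opensOver_isContinuous (p : Y ⟶ X) :
    (opensOver p).IsContinuous (Opens.grothendieckTopology Y) (Scheme.zariskiTopology.over X) :=
  Functor.isContinuous_comp _ _ _ (Scheme.zariskiTopology.over Y) _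

/-- The restriction of a sheaf on the big Zariski site of `X` to the small Zariski site of an
`X`-scheme `Y`. -/
def restrictSmall (E : BigSheaf X) (p : Y ⟶ X) : SmallSheaf Y :=
  ((opensOver p).sheafPushforwardContinuous AddCommGrpCat.{u} (Opens.grothendieckTopology Y)
    (Scheme.zariskiTopology.over X)).obj E

/-- Direct image of sheaves on small Zariski sites. -/
abbrev directImage (h : Y' ⟶ Y) : SmallSheaf Y' ⥤ SmallSheaf Y :=
  (Opens.map h.base).sheafPushforwardContinuous AddCommGrpCat.{u}
    (Opens.grothendieckTopology Y) (Opens.grothendieckTopology Y')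

/-- Inverse image of sheaves on small Zariski sites. -/
abbrev inverseImage (h : Y' ⟶ Y) : SmallSheaf Y ⥤ SmallSheaf Y' :=
  (Opens.map h.base).sheafPullback AddCommGrpCat.{u}
    (Opens.grothendieckTopology Y) (Opens.grothendieckTopology Y')

/-- Inverse image is left adjoint to direct image. -/
abbrev imageAdjunction (h : Y' ⟶ Y) : inverseImage h ⊣ directImage h :=
  (Opens.map h.base).sheafAdjunctionContinuous AddCommGrpCat.{u}
    (Opens.grothendieckTopology Y) (Opens.grothendieckTopology Y')

/-- For a morphism `h : Y' ⟶ Y` of `X`-schemes and an open `U` of `Y`, the morphism of `X`-schemes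
`h⁻¹ U ⟶ U`. -/
def preimageOver {p : Y ⟶ X} {p' : Y' ⟶ X} (h : Y' ⟶ Y) (w : h ≫ p = p') (U : Y.Opens) :
    (opensOver p').obj (h ⁻¹ᵁ U) ⟶ (opensOver p).obj U :=
  Over.homMk (h ∣_ U) (by
    subst w
    exact morphismRestrict_ι_assoc h U p)

lemma preimageOver_naturality {p : Y ⟶ X} {p' : Y' ⟶ X} (h : Y' ⟶ Y) (w : h ≫ p = p')
    {U V : Y.Opens} (i : V ⟶ U) :
    preimageOver h w V ≫ (opensOver p).map i =
      (opensOver p').map ((Opens.map h.base).map i) ≫ preimageOver h w U := by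
  ext1
  change h ∣_ V ≫ Y.homOfLE i.le =
    Y'.homOfLE ((Opens.map h.base).map i).le ≫ h ∣_ U
  rw [← cancel_mono U.ι]
  simp

/-- For a morphism `h : Y' ⟶ Y` of `X`-schemes, the map `E|_Y ⟶ h_* (E|_Y')` which is given on an
open `U` of `Y` by restriction `E(U) ⟶ E(h⁻¹ U)`. -/
def restrictSmallMap (E : BigSheaf X) {p : Y ⟶ X} {p' : Y' ⟶ X} (h : Y' ⟶ Y) (w : h ≫ p = p') :
    restrictSmall E p ⟶ (directImage h).obj (restrictSmall E p') where
  hom :=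
    { app U := E.obj.map (preimageOver h w U.unop).op
      naturality U V i := by
        change E.obj.map _ ≫ E.obj.map _ = E.obj.map _ ≫ E.obj.map _
        rw [← E.obj.map_comp, ← E.obj.map_comp]
        congr 1
        exact congrArg Quiver.Hom.op (preimageOver_naturality h w i.unop) }

end BigZariski

section Cohomology

variable {Y Y' : Scheme.{u}}

instance inverseImage_preservesFiniteLimits (h : Y' ⟶ Y) :
    PreservesFiniteLimits (inverseImage h) := by
  have : RepresentablyFlat (Opens.map h.base) := inferInstance
  exact CategoryTheory.Functor.SmallCategories.instPreservesFiniteLimitsSheafSheafPullbackOfRepresentablyFlat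
    (Opens.map h.base) AddCommGrpCat.{u} (Opens.grothendieckTopology Y)
    (Opens.grothendieckTopology Y')

instance inverseImage_preservesFiniteColimits (h : Y' ⟶ Y) :
    PreservesFiniteColimits (inverseImage h) :=
  have := (imageAdjunction h).leftAdjoint_preservesColimits
  inferInstance

instance inverseImage_additive (h : Y' ⟶ Y) : (inverseImage h).Additive :=
  Functor.additive_of_preserves_binary_products _

/-- The constant sheaf `ℤ` on the small Zariski site of `Y`. -/
abbrev constZ (Y : Scheme.{u}) : SmallSheaf Y :=
  (constantSheaf (Opens.grothendieckTopology Y) AddCommGrpCat.{u}).obj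
    (AddCommGrpCat.of (ULift.{u} ℤ))

/-- The canonical map `ℤ ⟶ h⁻¹ ℤ` of sheaves on `Y'`; it corresponds to the global section of
`h⁻¹ ℤ` which is the inverse image of the section `1` of `ℤ` on `Y`. -/
def constZMap (h : Y' ⟶ Y) : constZ Y' ⟶ (inverseImage h).obj (constZ Y) :=
  ((constantSheafAdj (Opens.grothendieckTopology Y') AddCommGrpCat.{u}
    (isTerminalTop : IsTerminal (⊤ : Y'.Opens))).homEquiv _ _).symm
    ((constantSheafAdj (Opens.grothendieckTopology Y) AddCommGrpCat.{u}
      (isTerminalTop : IsTerminal (⊤ : Y.Opens))).unit.app (AddCommGrpCat.of (ULift.{u} ℤ)) ≫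
        ((imageAdjunction h).unit.app (constZ Y)).hom.app (op ⊤))

/-- For `h : Y' ⟶ Y`, sheaves `F` on `Y` and `G` on `Y'`, and a map `α : h⁻¹ F ⟶ G`, the induced
map `H^q(Y, F) → H^q(Y', h⁻¹ F) → H^q(Y', G)`. -/
def cohomologyMap (h : Y' ⟶ Y) {F : SmallSheaf Y} {G : SmallSheaf Y'}
    (α : (inverseImage h).obj F ⟶ G) (q : ℕ) : Sheaf.H.{u} F q →+ Sheaf.H.{u} G q :=
  (Sheaf.H.map α q).comp
    (((Abelian.Ext.mk₀ (constZMap h)).precomp ((inverseImage h).obj F) (zero_add q)).comp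
      ((inverseImage h).mapExtAddHom (constZ Y) F q))

end Cohomology

section FormalLieGroup

/-- The functor of points on `V`-schemes of the formal scheme `Spf(B[[x_1, …, x_d]])`, where
`V = Spec B` is affine. A morphism `Z ⟶ Spf(B[[x_1, …, x_d]])` over `V` is a homomorphism of
`B`-algebras `B[[x_1, …, x_d]] → Γ(Z, 𝒪_Z)` which is continuous for the `(x_1, …, x_d)`-adic
topology on the source and the pseudo-discrete topology on the target, i.e. which locally on `Z`
kills a power of the ideal `(x_1, …, x_d)`. -/
def formalSpace (V : Scheme.{u}) (d : ℕ) : (Over V)ᵒᵖ ⥤ Type u where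
  obj Z := {φ : MvPowerSeries (Fin d) Γ(V, ⊤) →+* Γ(Z.unop.left, ⊤) //
    φ.comp MvPowerSeries.C = Z.unop.hom.appTop.hom ∧
    ∀ z : Z.unop.left, ∃ W : Z.unop.left.Opens, z ∈ W ∧ ∃ n : ℕ,
      ∀ s ∈ (Ideal.span (Set.range (MvPowerSeries.X : Fin d → MvPowerSeries (Fin d) Γ(V, ⊤)))) ^ n,
        Z.unop.left.presheaf.map (homOfLE le_top : W ⟶ ⊤).op (φ s) = 0}
  map {Z Z'} h := ↾fun φ => ⟨h.unop.left.appTop.hom.comp φ.1, by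
    rw [RingHom.comp_assoc, φ.2.1, ← Over.w h.unop, Scheme.Hom.comp_appTop]
    rfl, by
    intro z
    obtain ⟨W, hz, n, hn⟩ := φ.2.2 (h.unop.left z)
    refine ⟨h.unop.left ⁻¹ᵁ W, hz, n, fun s hs => ?_⟩
    have := ConcreteCategory.congr_hom
      (h.unop.left.naturality (homOfLE le_top : W ⟶ ⊤).op) (φ.1 s)
    simp only [CommRingCat.comp_apply, hn s hs, map_zero] at this
    exact this.symm⟩
  map_id Z := by
    ext φ s
    simp
  map_comp g h := by
    ext φ s
    simp only [unop_comp, Over.comp_left, Scheme.Hom.comp_appTop]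
    rfl

/-- A sheaf `E` of abelian groups on the big Zariski site of `X` is a commutative formal Lie group
over `X` if every point of `X` has an affine open neighbourhood `U = Spec B` over which `E` is
isomorphic, as a sheaf of sets, to `Spf(B[[x_1, …, x_d]])` for some `d`, in such a way that
the zero of `E(U)` corresponds to `x_i ↦ 0`. -/
def IsFormalLieGroup {X : Scheme.{u}} (E : BigSheaf X) : Prop :=
  ∀ x : X, ∃ U : X.Opens, x ∈ U ∧ IsAffineOpen U ∧ ∃ d : ℕ,
    ∃ e : (Over.map U.ι).op ⋙ E.obj ⋙ forget AddCommGrpCat.{u} ≅ formalSpace U d,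
      ∀ i : Fin d, (e.hom.app (op (Over.mk (𝟙 (U : Scheme.{u}))))
        (0 : E.obj.obj (op ((Over.map U.ι).obj (Over.mk (𝟙 (U : Scheme.{u}))))))).1
          (MvPowerSeries.X i) = 0

end FormalLieGroup

section Deformation

variable {R : Type u} [CommRing R] {X : Scheme.{u}} (f : X ⟶ Spec (.of R)) (E : BigSheaf X)
variable (A : Type u) [CommRing A] [Algebra R A]
variable {B : Type u} [CommRing B] [Algebra R B] {C : Type u} [CommRing C] [Algebra R C]

/-- The base change `X_A = X ×_{Spec R} Spec A`. -/
abbrev baseChange : Scheme.{u} := pullback f (Spec.map (CommRingCat.ofHom (algebraMap R A)))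

/-- The projection `X_A ⟶ X`. -/
abbrev baseChangeFst : baseChange f A ⟶ X := pullback.fst _ _

variable {A}

/-- The morphism `X_B ⟶ X_A` induced by a homomorphism `A → B` of `R`-algebras. -/
def baseChangeMap (φ : A →ₐ[R] B) : baseChange f B ⟶ baseChange f A :=
  pullback.lift (pullback.fst _ _) (pullback.snd _ _ ≫ Spec.map (CommRingCat.ofHom φ.toRingHom)) (by
    rw [pullback.condition, Category.assoc, ← Spec.map_comp, ← CommRingCat.ofHom_comp]
    congr 3
    exact φ.comp_algebraMap.symm)

lemma baseChangeMap_fst (φ : A →ₐ[R] B) :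
    baseChangeMap f φ ≫ baseChangeFst f A = baseChangeFst f B :=
  pullback.lift_fst _ _ _

lemma baseChangeMap_comp (φ : A →ₐ[R] B) (ψ : B →ₐ[R] C) :
    baseChangeMap f ψ ≫ baseChangeMap f φ = baseChangeMap f (ψ.comp φ) := by
  apply pullback.hom_ext
  · rw [Category.assoc, baseChangeMap_fst, baseChangeMap_fst, baseChangeMap_fst]
  · simp only [baseChangeMap, Category.assoc, pullback.lift_snd, pullback.lift_snd_assoc]
    rw [← Spec.map_comp, ← CommRingCat.ofHom_comp]
    rfl

variable (A)

/-- The closed immersion `ι : X ×_S T_red ⟶ X ×_S T` for `S = Spec R` and `T = Spec A`. -/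
abbrev redInclusion : baseChange f (A ⧸ nilradical A) ⟶ baseChange f A :=
  baseChangeMap f (Ideal.Quotient.mkₐ R (nilradical A))

/-- The restriction map `E ⟶ ι_* E` of sheaves on `X_A`. -/
abbrev redRestriction : restrictSmall E (baseChangeFst f A) ⟶
    (directImage (redInclusion f A)).obj (restrictSmall E (baseChangeFst f (A ⧸ nilradical A))) :=
  restrictSmallMap E (redInclusion f A) (baseChangeMap_fst f _)

/-- The sheaf `Ẽ_T = ker(E ⟶ ι_* E)` on the small Zariski site of `X_T`, where `T = Spec A`. -/
def tildeSheaf : SmallSheaf (baseChange f A) := kernel (redRestriction f E A)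

/-- The inclusion of `Ẽ_T` into the restriction of `E` to `X_T`. -/
def tildeSheafι : tildeSheaf f E A ⟶ restrictSmall E (baseChangeFst f A) :=
  kernel.ι (redRestriction f E A)

variable {A}

lemma comp_map_comp_map_eq_zero (P : (Over X)ᵒᵖ ⥤ AddCommGrpCat.{u}) {M : AddCommGrpCat.{u}}
    {a b c d : Over X} (t : M ⟶ P.obj (op a)) (i : b ⟶ a) (j : c ⟶ b) (k : c ⟶ d) (r : d ⟶ a)
    (h : t ≫ P.map r.op = 0) (w : j ≫ i = k ≫ r) : (t ≫ P.map i.op) ≫ P.map j.op = 0 := by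
  rw [Category.assoc, ← P.map_comp, ← op_comp, w, op_comp, P.map_comp, reassoc_of% h, zero_comp]

lemma tildeSheaf_condition (φ : A →ₐ[R] B) :
    (tildeSheafι f E A ≫
      restrictSmallMap E (baseChangeMap f φ) (baseChangeMap_fst f φ)) ≫
        (directImage (baseChangeMap f φ)).map (redRestriction f E B) = 0 := by
  apply Sheaf.hom_ext
  apply NatTrans.ext
  funext U
  let V : (baseChange f A).Opens := U.unop
  let π := baseChangeMap f φ
  let ρ := baseChangeMap f (redMap φ)
  have hcomm : redInclusion f B ≫ π = ρ ≫ redInclusion f A := by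
    rw [baseChangeMap_comp, baseChangeMap_comp]
    rfl
  have h0 : (tildeSheafι f E A).hom.app U ≫
      E.obj.map (preimageOver (redInclusion f A) (baseChangeMap_fst f _) V).op = 0 :=
    congrArg (fun t => t.hom.app U) (kernel.condition (redRestriction f E A))
  let W : (baseChange f (B ⧸ nilradical B)).Opens := redInclusion f B ⁻¹ᵁ π ⁻¹ᵁ V
  let W' : (baseChange f (A ⧸ nilradical A)).Opens := redInclusion f A ⁻¹ᵁ V
  have hr : Set.range (W.ι ≫ ρ) ⊆ Set.range W'.ι := by
    rw [Scheme.Opens.range_ι]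
    rintro _ ⟨z, rfl⟩
    have hz : (redInclusion f B ≫ π) z.1 ∈ V := z.2
    rw [hcomm] at hz
    exact hz
  let l : (W : Scheme.{u}) ⟶ W' := IsOpenImmersion.lift W'.ι (W.ι ≫ ρ) hr
  have hl : l ≫ W'.ι = W.ι ≫ ρ := IsOpenImmersion.lift_fac W'.ι (W.ι ≫ ρ) hr
  let k : (opensOver (baseChangeFst f (B ⧸ nilradical B))).obj W ⟶
      (opensOver (baseChangeFst f (A ⧸ nilradical A))).obj W' := Over.homMk l (by
    change l ≫ W'.ι ≫ baseChangeFst f _ = W.ι ≫ baseChangeFst f _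
    rw [← Category.assoc, hl, Category.assoc, baseChangeMap_fst])
  have hk : preimageOver (redInclusion f B) (baseChangeMap_fst f _) (π ⁻¹ᵁ V) ≫
      preimageOver π (baseChangeMap_fst f φ) V =
        k ≫ preimageOver (redInclusion f A) (baseChangeMap_fst f _) V := by
    ext1
    change redInclusion f B ∣_ (π ⁻¹ᵁ V) ≫ π ∣_ V = l ≫ redInclusion f A ∣_ V
    rw [← cancel_mono V.ι]
    simp only [Category.assoc, morphismRestrict_ι]
    rw [← Category.assoc l, hl, morphismRestrict_ι_assoc, Category.assoc, ← hcomm]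
  exact comp_map_comp_map_eq_zero E.obj _ _ _ _ _ h0 hk

/-- For `T' = Spec B ⟶ T = Spec A`, the natural map from the inverse image of `Ẽ_T` to `Ẽ_T'`; it
is induced by the restriction maps `E(U) ⟶ E(U ×_T T')`. -/
def tildeSheafMap (φ : A →ₐ[R] B) :
    (inverseImage (baseChangeMap f φ)).obj (tildeSheaf f E A) ⟶ tildeSheaf f E B :=
  kernel.lift _ (((imageAdjunction (baseChangeMap f φ)).homEquiv _ _).symm
    (tildeSheafι f E A ≫
      restrictSmallMap E (baseChangeMap f φ) (baseChangeMap_fst f φ))) (by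
    rw [← Adjunction.homEquiv_naturality_right_symm, tildeSheaf_condition,
      Adjunction.homEquiv_counit]
    simp)

variable (A)

/-- `H^q(X_A, Ẽ_{Spec A})`. -/
abbrev deformationH (q : ℕ) : Type u := Sheaf.H.{u} (tildeSheaf f E A) q

variable {A}

/-- The map `H^q(X_A, Ẽ_{Spec A}) → H^q(X_B, Ẽ_{Spec B})` induced by a homomorphism `A → B` of
`R`-algebras. -/
def deformationHMap (φ : A →ₐ[R] B) (q : ℕ) : deformationH f E A q →+ deformationH f E B q :=
  cohomologyMap (baseChangeMap f φ) (tildeSheafMap f E φ) q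

variable (A)

/-- The map `H^q(X_{N_R(A)}, Ẽ) → H^q(X_A, Ẽ)` induced by `N_R(A) → A`. -/
def nilHullComparison (q : ℕ) : deformationH f E (NilHull R A) q →+ deformationH f E A q :=
  deformationHMap f E (NilHull.toAlgebra R A) q

end Deformation

end DeformationCohomology

end

open DeformationCohomology

noncomputable section

namespace CategoryTheory.Abelian.Ext

universe w w' w'' v v' v'' u' u'' u'''

/-- Every object is the first term of a short exact sequence with injective middle term. -/
lemma exists_shortExact_injective {C : Type u'} [Category.{v} C] [Abelian C] [EnoughInjectives C]
    (F : C) : ∃ S : ShortComplex C, S.X₁ = F ∧ Injective S.X₂ ∧ S.ShortExact :=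
  ⟨ShortComplex.mk (Injective.ι F) (cokernel.π _) (cokernel.condition _), rfl,
    inferInstanceAs (Injective (Injective.under F)),
    { exact := ShortComplex.exact_of_g_is_cokernel _ (cokernelIsCokernel _) }⟩

/-- Dimension shifting: a class of positive degree factors through the extension class of an
embedding into an injective object. -/
lemma exists_comp_extClass_of_injective {C : Type u'} [Category.{v} C] [Abelian C] [HasExt.{w} C]
    {X : C} {n : ℕ} {S : ShortComplex C} (hS : S.ShortExact)
    (_ : Injective S.X₂) (x : Ext.{w} X S.X₁ (n + 1)) :
    ∃ y : Ext.{w} X S.X₃ n, y.comp hS.extClass rfl = x :=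
  covariant_sequence_exact₁ X hS x (eq_zero_of_injective _) rfl

section

variable {C : Type u'} [Category.{v} C] [Abelian C] [HasExt.{w} C] [EnoughInjectives C]
  {D : Type u''} [Category.{v'} D] [Abelian D] [HasExt.{w'} D]
  {D' : Type u'''} [Category.{v''} D'] [Abelian D'] [HasExt.{w''} D']

lemma mapExactFunctor_naturality {L₁ L₂ : C ⥤ D} [L₁.Additive] [L₂.Additive]
    [PreservesFiniteLimits L₁] [PreservesFiniteColimits L₁]
    [PreservesFiniteLimits L₂] [PreservesFiniteColimits L₂] (τ : L₁ ⟶ L₂) {X Y : C} {n : ℕ}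
    (x : Ext.{w} X Y n) :
    (x.mapExactFunctor L₁ : Ext.{w'} _ _ n).comp (mk₀ (τ.app Y)) (add_zero n) =
      (mk₀ (τ.app X)).comp (x.mapExactFunctor L₂) (zero_add n) := by
  induction n generalizing Y with
  | zero =>
    obtain ⟨f, rfl⟩ := (mk₀_bijective X Y).2 x
    simp [mapExactFunctor_mk₀]
  | succ n ih =>
    obtain ⟨S, rfl, hI, hS⟩ := exists_shortExact_injective Y
    obtain ⟨y, rfl⟩ := exists_comp_extClass_of_injective hS hI x
    have key : (hS.extClass.mapExactFunctor L₁ : Ext.{w'} _ _ 1).comp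
        (mk₀ (τ.app S.X₁)) (add_zero 1) =
        (mk₀ (τ.app S.X₃)).comp (hS.extClass.mapExactFunctor L₂) (zero_add 1) := by
      rw [mapExactFunctor_extClass, mapExactFunctor_extClass]
      exact ShortComplex.ShortExact.extClass_naturality (hS.map_of_exact L₁)
        (hS.map_of_exact L₂) (S.mapNatTrans τ)
    rw [mapExactFunctor_comp, mapExactFunctor_comp, comp_assoc_of_third_deg_zero, key,
      ← comp_assoc_of_second_deg_zero, ih y, comp_assoc _ _ _ (zero_add n) rfl (by omega)]

lemma mapExactFunctor_mapExactFunctor (L : C ⥤ D) (L' : D ⥤ D') [L.Additive]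
    [L'.Additive] [PreservesFiniteLimits L] [PreservesFiniteColimits L]
    [PreservesFiniteLimits L'] [PreservesFiniteColimits L'] {X Y : C} {n : ℕ}
    (x : Ext.{w} X Y n) :
    ((x.mapExactFunctor L : Ext.{w'} _ _ n).mapExactFunctor L' : Ext.{w''} _ _ n) =
      x.mapExactFunctor (L ⋙ L') := by
  induction n generalizing Y with
  | zero =>
    obtain ⟨f, rfl⟩ := (mk₀_bijective X Y).2 x
    simp [mapExactFunctor_mk₀]
  | succ n ih =>
    obtain ⟨S, rfl, hI, hS⟩ := exists_shortExact_injective Y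
    obtain ⟨y, rfl⟩ := exists_comp_extClass_of_injective hS hI x
    have key : ((hS.extClass.mapExactFunctor L : Ext.{w'} _ _ 1).mapExactFunctor L' :
        Ext.{w''} _ _ 1) = hS.extClass.mapExactFunctor (L ⋙ L') := by
      rw [mapExactFunctor_extClass, mapExactFunctor_extClass]
      exact mapExactFunctor_extClass L' (hS.map_of_exact L)
    rw [mapExactFunctor_comp, mapExactFunctor_comp, mapExactFunctor_comp, key, ih]

end

section Adjunction

variable {C : Type u'} [Category.{v} C] [Abelian C] [HasExt.{w} C]
  {D : Type u''} [Category.{v'} D] [Abelian D] [HasExt.{w'} D]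
  {L : C ⥤ D} {R : D ⥤ C} (adj : L ⊣ R) [L.Additive] [PreservesFiniteLimits L]
  [PreservesFiniteColimits L]

/-- For an adjunction `L ⊣ R` with `L` exact, the map `Ext(X, R F) → Ext(L X, F)`. -/
noncomputable def adjunctionMap (X : C) (F : D) (n : ℕ) :
    Ext.{w} X (R.obj F) n →+ Ext.{w'} (L.obj X) F n :=
  ((mk₀ (adj.counit.app F)).postcomp _ (add_zero _)).comp (L.mapExtAddHom _ _ _)

lemma adjunctionMap_apply {X : C} {F : D} {n : ℕ} (x : Ext.{w} X (R.obj F) n) :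
    (adjunctionMap adj X F n x : Ext.{w'} _ _ n) =
      (x.mapExactFunctor L).comp (mk₀ (adj.counit.app F)) (add_zero n) := rfl

lemma adjunctionMap_mk₀ {X : C} {F : D} (f : X ⟶ R.obj F) :
    (adjunctionMap adj X F 0 (mk₀ f) : Ext.{w'} _ _ 0) = mk₀ ((adj.homEquiv X F).symm f) := by
  simp [adjunctionMap_apply, mapExactFunctor_mk₀, Adjunction.homEquiv_counit]

lemma adjunctionMap_comp_mk₀ {X : C} {F G : D} {n : ℕ} (x : Ext.{w} X (R.obj F) n) (f : F ⟶ G) :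
    (adjunctionMap adj X G n (x.comp (mk₀ (R.map f)) (add_zero n)) : Ext.{w'} _ _ n) =
      (adjunctionMap adj X F n x).comp (mk₀ f) (add_zero n) := by
  have := adj.counit.naturality f
  dsimp at this
  simp only [adjunctionMap_apply, mapExactFunctor_comp, mapExactFunctor_mk₀,
    comp_assoc_of_third_deg_zero, mk₀_comp_mk₀, this]

lemma adjunctionMap_comp_extClass {X : C} {n : ℕ} {S : ShortComplex D} (hS : S.ShortExact)
    [R.Additive] (hRS : (S.map R).ShortExact) (e : Ext.{w} (R.obj S.X₃) (R.obj S.X₁) 1)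
    (he : e = hRS.extClass) (x : Ext.{w} X (R.obj S.X₃) n) :
    (adjunctionMap adj X S.X₁ (n + 1) (x.comp e rfl) : Ext.{w'} _ _ (n + 1)) =
      (adjunctionMap adj X S.X₃ n x).comp hS.extClass rfl := by
  have key : (e.mapExactFunctor L : Ext.{w'} _ _ 1).comp (mk₀ (adj.counit.app S.X₁)) (add_zero 1) =
      (mk₀ (adj.counit.app S.X₃)).comp hS.extClass (zero_add 1) := by
    let τ : (S.map R).map L ⟶ S :=
      { τ₁ := adj.counit.app _, τ₂ := adj.counit.app _, τ₃ := adj.counit.app _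
        comm₁₂ := (adj.counit.naturality S.f).symm
        comm₂₃ := (adj.counit.naturality S.g).symm }
    refine Eq.trans ?_ (ShortComplex.ShortExact.extClass_naturality (hRS.map_of_exact L) hS τ)
    rw [he]
    exact congrArg (fun z => z.comp (mk₀ (adj.counit.app S.X₁)) (add_zero 1))
      (mapExactFunctor_extClass L hRS)
  rw [adjunctionMap_apply, adjunctionMap_apply, mapExactFunctor_comp, comp_assoc_of_third_deg_zero,
    key, ← comp_assoc_of_second_deg_zero]

/-- If `L ⊣ R` with `L` exact and `F` lies in a class of objects containing the injectives, stable
under cokernels of embeddings into injectives, and for which `R` preserves the exactness of such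
embeddings, then `Ext(X, R F) → Ext(L X, F)` is bijective. -/
theorem adjunctionMap_bijective [EnoughInjectives D] [R.Additive] (P : D → Prop)
    (hI : ∀ I, Injective I → P I)
    (hP : ∀ S : ShortComplex D, S.ShortExact → Injective S.X₂ → P S.X₁ →
      P S.X₃ ∧ Epi (R.map S.g)) (X : C) (F : D) (hF : P F) (n : ℕ) :
    Function.Bijective (adjunctionMap.{w, w'} adj X F n) := by
  induction n generalizing F with
  | zero =>
    rw [← Function.Bijective.of_comp_iff _ (mk₀_bijective X (R.obj F))]
    rw [show (adjunctionMap adj X F 0) ∘ mk₀ = mk₀ ∘ (adj.homEquiv X F).symm from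
      funext fun f => adjunctionMap_mk₀ adj f]
    exact (mk₀_bijective _ _).comp (Equiv.bijective _)
  | succ n ih =>
    obtain ⟨S, rfl, hinj, hS⟩ := exists_shortExact_injective F
    obtain ⟨hQ, hepi⟩ := hP _ hS hinj hF
    have := adj.rightAdjoint_preservesLimits
    have hRS : (S.map R).ShortExact := by
      have hR : PreservesFiniteLimits R := inferInstance
      have h := (((Functor.preservesFiniteLimits_tfae R).out 3 1 rfl rfl).1 hR) S
        ⟨hS.exact, hS.mono_f⟩
      exact { exact := h.1, mono_f := h.2, epi_g := hepi }
    have hRinj : Injective (R.obj S.X₂) := Injective.injective_of_adjoint adj S.X₂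
    obtain ⟨e, he⟩ : ∃ e : Ext.{w} (R.obj S.X₃) (R.obj S.X₁) 1, e = hRS.extClass := ⟨_, rfl⟩
    have hge : (mk₀ (R.map S.g)).comp e (zero_add 1) = 0 := he ▸ hRS.comp_extClass
    have hex (x : Ext.{w} X (R.obj S.X₁) (n + 1)) : ∃ y : Ext.{w} X (R.obj S.X₃) n,
        y.comp e rfl = x := he ▸ exists_comp_extClass_of_injective hRS hRinj x
    constructor
    · rw [injective_iff_map_eq_zero]
      intro x hx
      obtain ⟨y, rfl⟩ := hex x
      rw [adjunctionMap_comp_extClass adj hS hRS e he] at hx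
      obtain ⟨w, hw⟩ := covariant_sequence_exact₃ _ hS _ rfl hx
      obtain ⟨w', rfl⟩ := (ih S.X₂ (hI _ hinj)).2 w
      rw [← adjunctionMap_comp_mk₀] at hw
      rw [← (ih S.X₃ hQ).1 hw, comp_assoc_of_second_deg_zero, hge, comp_zero]
    · intro y
      obtain ⟨y', rfl⟩ := exists_comp_extClass_of_injective hS hinj y
      obtain ⟨x, rfl⟩ := (ih S.X₃ hQ).2 y'
      exact ⟨_, adjunctionMap_comp_extClass adj hS hRS e he x⟩

end Adjunction

end CategoryTheory.Abelian.Ext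

namespace DeformationCohomology

open Abelian

variable {Y Y' Y'' : Scheme.{u}}

/-- Maps from the constant sheaf `ℤ` to `F` correspond to global sections of `F`. -/
abbrev constZHomEquiv (F : SmallSheaf Y) :
    (constZ Y ⟶ F) ≃ (AddCommGrpCat.of (ULift.{u} ℤ) ⟶ F.obj.obj (op (⊤ : Y.Opens))) :=
  (constantSheafAdj (Opens.grothendieckTopology Y) AddCommGrpCat.{u}
      (isTerminalTop : IsTerminal (⊤ : Y.Opens))).homEquiv _ F

lemma constZHomEquiv_comp {F G : SmallSheaf Y} (a : constZ Y ⟶ F) (b : F ⟶ G) :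
    constZHomEquiv G (a ≫ b) = constZHomEquiv F a ≫ b.hom.app (op ⊤) :=
  Adjunction.homEquiv_naturality_right _ _ _

lemma constZHomEquiv_constZMap_comp (h : Y' ⟶ Y) {F : SmallSheaf Y'}
    (θ : constZ Y ⟶ (directImage h).obj F) :
    constZHomEquiv F (constZMap h ≫ ((imageAdjunction h).homEquiv _ _).symm θ) =
      constZHomEquiv _ θ := by
  rw [constZHomEquiv_comp]
  have h1 : constZHomEquiv _ (constZMap h) =
      (constantSheafAdj (Opens.grothendieckTopology Y) AddCommGrpCat.{u}
      (isTerminalTop : IsTerminal (⊤ : Y.Opens))).unit.app (AddCommGrpCat.of (ULift.{u} ℤ)) ≫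
        ((imageAdjunction h).unit.app (constZ Y)).hom.app (op ⊤) := Equiv.apply_symm_apply _ _
  have h2 := congrArg (fun t => t.hom.app (op ⊤))
    (((imageAdjunction h).homEquiv _ _).apply_symm_apply θ)
  rw [Adjunction.homEquiv_unit] at h2
  rw [h1, constZHomEquiv, Adjunction.homEquiv_unit]
  exact (Category.assoc _ _ _).trans (congrArg (fun t => _ ≫ t) h2)

instance constZMap_isIso (h : Y' ⟶ Y) : IsIso (constZMap h) := by
  rw [isIso_iff_coyoneda_map_bijective]
  intro F
  have : (fun (x : (inverseImage h).obj (constZ Y) ⟶ F) => constZMap h ≫ x) =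
      (constZHomEquiv F).symm ∘ constZHomEquiv ((directImage h).obj F) ∘
        ((imageAdjunction h).homEquiv _ _) := by
    funext x
    refine (Equiv.eq_symm_apply _).2 (Eq.trans ?_ (constZHomEquiv_constZMap_comp h _))
    rw [Equiv.symm_apply_apply]
  rw [this]
  exact (Equiv.bijective _).comp ((Equiv.bijective _).comp (Equiv.bijective _))

lemma cohomologyMap_apply (h : Y' ⟶ Y) {F : SmallSheaf Y} {G : SmallSheaf Y'}
    (α : (inverseImage h).obj F ⟶ G) (q : ℕ) (x : Sheaf.H.{u} F q) :
    cohomologyMap h α q x =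
      ((Ext.mk₀ (constZMap h)).comp (x.mapExactFunctor (inverseImage h)) (zero_add q)).comp
        (Ext.mk₀ α) (add_zero q) := rfl

/-- Inverse images are compatible with composition. -/
def inverseImageComp (h : Y' ⟶ Y) (h' : Y'' ⟶ Y') :
    inverseImage (h' ≫ h) ≅ inverseImage h ⋙ inverseImage h' :=
  (imageAdjunction (h' ≫ h)).leftAdjointUniq ((imageAdjunction h).comp (imageAdjunction h'))

lemma homEquiv_symm_inverseImageComp (h : Y' ⟶ Y) (h' : Y'' ⟶ Y') {F : SmallSheaf Y}
    {G : SmallSheaf Y'} {K : SmallSheaf Y''} (θ : F ⟶ (directImage h).obj G)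
    (θ' : G ⟶ (directImage h').obj K) :
    (inverseImageComp h h').hom.app F ≫
        (inverseImage h').map (((imageAdjunction h).homEquiv _ _).symm θ) ≫
          ((imageAdjunction h').homEquiv _ _).symm θ' =
      ((imageAdjunction (h' ≫ h)).homEquiv F K).symm (θ ≫ (directImage h).map θ') := by
  rw [Equiv.eq_symm_apply, Adjunction.homEquiv_naturality_right]
  rw [show (imageAdjunction (h' ≫ h)).homEquiv _ _ ((inverseImageComp h h').hom.app F) = _ from
    Adjunction.homEquiv_leftAdjointUniq_hom_app _ _ F]
  refine (Adjunction.homEquiv_unit ((imageAdjunction h).comp (imageAdjunction h')) F K _).symm.trans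
    ?_
  rw [Adjunction.comp_homEquiv]
  refine Eq.trans (b := (imageAdjunction h).homEquiv F _ ((imageAdjunction h').homEquiv _ K
    ((inverseImage h').map (((imageAdjunction h).homEquiv _ _).symm θ) ≫
          ((imageAdjunction h').homEquiv _ _).symm θ'))) rfl ?_
  rw [Adjunction.homEquiv_naturality_left, Equiv.apply_symm_apply,
    Adjunction.homEquiv_naturality_right, Equiv.apply_symm_apply]
  rfl

lemma constZMap_comp (h : Y' ⟶ Y) (h' : Y'' ⟶ Y') :
    constZMap (h' ≫ h) ≫ (inverseImageComp h h').hom.app (constZ Y) =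
      constZMap h' ≫ (inverseImage h').map (constZMap h) := by
  have h2 : (inverseImageComp h h').hom.app (constZ Y) =
      ((imageAdjunction (h' ≫ h)).homEquiv (constZ Y) _).symm
        ((imageAdjunction h).homEquiv _ _ (𝟙 _) ≫
          (directImage h).map ((imageAdjunction h').homEquiv _ _ (𝟙 _))) := by
    rw [← homEquiv_symm_inverseImageComp, Equiv.symm_apply_apply, Equiv.symm_apply_apply]
    simp
  have h3 : (inverseImage h').map (constZMap h) = ((imageAdjunction h').homEquiv _ _).symm
      (constZMap h ≫ (imageAdjunction h').homEquiv _ _ (𝟙 _)) := by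
    rw [Adjunction.homEquiv_naturality_left_symm, Equiv.symm_apply_apply, Category.comp_id]
  apply (constZHomEquiv _).injective
  rw [h3, h2]
  refine Eq.trans ?_ (constZHomEquiv_constZMap_comp h' _).symm
  refine (constZHomEquiv_constZMap_comp (h' ≫ h) _).trans ?_
  have h4 : (imageAdjunction h).homEquiv (constZ Y) _ (𝟙 _) ≫
      (directImage h).map ((imageAdjunction h').homEquiv _ _ (𝟙 _)) =
        (imageAdjunction h).homEquiv _ _ ((imageAdjunction h').homEquiv _ _ (𝟙 _)) := by
    rw [← Adjunction.homEquiv_naturality_right, Category.id_comp]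
  refine (congrArg (constZHomEquiv ((directImage h).obj _)) h4).trans ?_
  refine (constZHomEquiv_constZMap_comp h _).symm.trans ?_
  rw [Equiv.symm_apply_apply]
  rfl

lemma cohomologyMap_comp (h : Y' ⟶ Y) (h' : Y'' ⟶ Y') {F : SmallSheaf Y}
    {G : SmallSheaf Y'} {K : SmallSheaf Y''} (θ : F ⟶ (directImage h).obj G)
    (θ' : G ⟶ (directImage h').obj K) (q : ℕ) (x : Sheaf.H.{u} F q) :
    cohomologyMap h' (((imageAdjunction h').homEquiv _ _).symm θ') q
        (cohomologyMap h (((imageAdjunction h).homEquiv _ _).symm θ) q x) =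
      cohomologyMap (h' ≫ h)
        (((imageAdjunction (h' ≫ h)).homEquiv F K).symm (θ ≫ (directImage h).map θ')) q x := by
  rw [← homEquiv_symm_inverseImageComp]
  simp only [cohomologyMap_apply, Ext.mapExactFunctor_comp, Ext.mapExactFunctor_mk₀]
  rw [Ext.mapExactFunctor_mapExactFunctor, ← Ext.mk₀_comp_mk₀, ← Ext.mk₀_comp_mk₀]
  have h1 := Ext.mapExactFunctor_naturality (inverseImageComp h h').hom x
  have h2 := constZMap_comp h h'
  simp only [← Ext.comp_assoc_of_third_deg_zero, ← Ext.comp_assoc_of_second_deg_zero]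
  rw [Ext.comp_assoc_of_third_deg_zero _ _ (Ext.mk₀ ((inverseImageComp h h').hom.app F)), h1,
    ← Ext.comp_assoc_of_second_deg_zero, Ext.mk₀_comp_mk₀, Ext.mk₀_comp_mk₀, h2]

/-- The sheaf of abelian groups freely generated by an open subset. -/
abbrev freeSheaf (V : Y.Opens) : SmallSheaf Y :=
  (presheafToSheaf (Opens.grothendieckTopology Y) AddCommGrpCat.{u}).obj
    (yoneda.obj V ⋙ AddCommGrpCat.free)

/-- The map of free sheaves induced by an inclusion of opens. -/
abbrev freeSheafMap {V W : Y.Opens} (i : V ⟶ W) : freeSheaf V ⟶ freeSheaf W :=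
  (presheafToSheaf (Opens.grothendieckTopology Y) AddCommGrpCat.{u}).map
    (Functor.whiskerRight (yoneda.map i) AddCommGrpCat.free)

/-- Maps from the free sheaf on `V` are sections over `V`. -/
def freeSheafHomEquiv (V : Y.Opens) (F : SmallSheaf Y) :
    (freeSheaf V ⟶ F) ≃ F.obj.obj (op V) :=
  ((sheafificationAdjunction (Opens.grothendieckTopology Y) AddCommGrpCat.{u}).homEquiv _ F).trans
    (((AddCommGrpCat.adj.whiskerRight (Y.Opens)ᵒᵖ).homEquiv (yoneda.obj V) F.obj).trans yonedaEquiv)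

lemma freeSheafHomEquiv_comp {V : Y.Opens} {F G : SmallSheaf Y} (s : freeSheaf V ⟶ F) (g : F ⟶ G) :
    freeSheafHomEquiv V G (s ≫ g) = g.hom.app (op V) (freeSheafHomEquiv V F s) := by
  simp only [freeSheafHomEquiv, Equiv.trans_apply, Adjunction.homEquiv_naturality_right]
  rfl

lemma freeSheafHomEquiv_map {V W : Y.Opens} (i : V ⟶ W) {F : SmallSheaf Y} (s : freeSheaf W ⟶ F) :
    freeSheafHomEquiv V F (freeSheafMap i ≫ s) = F.obj.map i.op (freeSheafHomEquiv W F s) := by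
  simp only [freeSheafHomEquiv, Equiv.trans_apply, Adjunction.homEquiv_naturality_left]
  have := (AddCommGrpCat.adj.whiskerRight (Y.Opens)ᵒᵖ).homEquiv_naturality_left (yoneda.map i)
    (((sheafificationAdjunction (Opens.grothendieckTopology Y) AddCommGrpCat.{u}).homEquiv _ F) s)
  refine (congrArg yonedaEquiv this).trans ?_
  exact (yonedaEquiv_naturality _ _).symm

instance (h : Y' ⟶ Y) : (directImage h).Additive where

lemma shortExact_section_surjective {S : ShortComplex (SmallSheaf Y)} (hS : S.ShortExact)
    {V : Y.Opens} (hV : Subsingleton (Ext.{u} (freeSheaf V) S.X₁ 1)) :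
    Function.Surjective (S.g.hom.app (op V)) := by
  intro s
  obtain ⟨t, rfl⟩ := (freeSheafHomEquiv V S.X₃).surjective s
  obtain ⟨z, hz⟩ := Ext.covariant_sequence_exact₃ _ hS (Ext.mk₀ t) (zero_add 1)
    (Subsingleton.elim _ _)
  obtain ⟨w, rfl⟩ := (Ext.mk₀_bijective _ _).2 z
  rw [Ext.mk₀_comp_mk₀] at hz
  rw [← (Ext.mk₀_bijective _ _).1 hz, freeSheafHomEquiv_comp]
  exact ⟨_, rfl⟩

/-- A morphism of sheaves is an epimorphism if it is surjective over a basis of opens. -/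
lemma epi_of_surjective_basis {F G : SmallSheaf Y} (g : F ⟶ G)
    (hg : ∀ (U : Y.Opens) (y : Y), y ∈ U → ∃ V ≤ U, y ∈ V ∧
      Function.Surjective (g.hom.app (op V))) : Epi g := by
  refine (TopCat.Sheaf.isLocallySurjective_iff_epi (X := Y.toTopCat) g).1 ?_
  rw [TopCat.Presheaf.isLocallySurjective_iff]
  intro U t y hy
  obtain ⟨V, hVU, hyV, hs⟩ := hg U y hy
  obtain ⟨s, hs⟩ := hs (G.obj.map (homOfLE hVU).op t)
  exact ⟨V, hVU, ⟨s, hs⟩, hyV⟩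

/-- Higher direct images of `F` vanish on a basis of opens. -/
def IsDirectImageAcyclic (h : Y' ⟶ Y) (F : SmallSheaf Y') : Prop :=
  ∀ (U : Y.Opens) (y : Y), y ∈ U → ∃ V ≤ U, y ∈ V ∧
    ∀ n : ℕ, Subsingleton (Ext.{u} (freeSheaf (h ⁻¹ᵁ V)) F (n + 1))

theorem cohomologyMap_bijective (h : Y' ⟶ Y) {G : SmallSheaf Y} {F : SmallSheaf Y'}
    (θ : G ⟶ (directImage h).obj F) [IsIso θ] (hF : IsDirectImageAcyclic h F) (q : ℕ) :
    Function.Bijective (cohomologyMap h (((imageAdjunction h).homEquiv _ _).symm θ) q) := by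
  have key := Ext.adjunctionMap_bijective.{u, u} (imageAdjunction h) (IsDirectImageAcyclic h)
    (fun I hI U y hy => ⟨U, le_rfl, hy, fun n => Ext.subsingleton_of_injective _ _ _⟩)
    (fun S hS hI h1 => ?_) (constZ Y) F hF q
  · have hb : Function.Bijective ((Ext.mk₀ (constZMap h)).precomp F (zero_add q) :
        Ext.{u} ((inverseImage h).obj (constZ Y)) F q → Ext.{u} (constZ Y') F q) := by
      refine Function.bijective_iff_has_inverse.2
        ⟨(Ext.mk₀ (inv (constZMap h))).precomp F (zero_add q), fun x => ?_, fun x => ?_⟩ <;>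
      simp
    have ha : Function.Bijective ((Ext.mk₀ θ).postcomp (constZ Y) (add_zero q) :
        Ext.{u} (constZ Y) G q → Ext.{u} (constZ Y) _ q) := by
      refine Function.bijective_iff_has_inverse.2
        ⟨(Ext.mk₀ (inv θ)).postcomp (constZ Y) (add_zero q), fun x => ?_, fun x => ?_⟩ <;>
      simp
    convert hb.comp (key.comp ha) using 1
    funext x
    simp only [cohomologyMap_apply, Function.comp_apply, Ext.adjunctionMap_apply,
      Adjunction.homEquiv_counit, Ext.bilinearComp_apply_apply, AddMonoidHom.flip_apply]
    rw [Ext.mapExactFunctor_comp, Ext.mapExactFunctor_mk₀, Ext.comp_assoc_of_third_deg_zero,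
      Ext.comp_assoc_of_third_deg_zero, Ext.mk₀_comp_mk₀]
  · constructor
    · intro U y hy
      obtain ⟨V, hVU, hyV, hV⟩ := h1 U y hy
      refine ⟨V, hVU, hyV, fun n => subsingleton_of_forall_eq 0 fun x => ?_⟩
      have h0 : x.comp hS.extClass rfl = 0 := (hV (n + 1)).elim _ _
      obtain ⟨z, rfl⟩ := Ext.covariant_sequence_exact₃ _ hS x rfl h0
      rw [Ext.eq_zero_of_injective z, Ext.zero_comp]
    · refine epi_of_surjective_basis _ fun U y hy => ?_
      obtain ⟨V, hVU, hyV, hV⟩ := h1 U y hy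
      exact ⟨V, hVU, hyV, shortExact_section_surjective hS (hV 0)⟩

end DeformationCohomology

namespace DeformationCohomology

open Abelian

variable {Y : Scheme.{u}}

/-- Restriction of cohomology classes to a smaller open. -/
def restrictExt {F : SmallSheaf Y} {n : ℕ} {V W : Y.Opens} (i : V ≤ W) :
    Ext.{u} (freeSheaf W) F n →+ Ext.{u} (freeSheaf V) F n :=
  (Ext.mk₀ (freeSheafMap (homOfLE i))).precomp F (zero_add n)

section

variable {F G : SmallSheaf Y} {n : ℕ} {V W : Y.Opens}

lemma freeSheafMap_comp {U : Y.Opens} (i : U ⟶ V) (j : V ⟶ W) :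
    freeSheafMap i ≫ freeSheafMap j = freeSheafMap (i ≫ j) := by
  rw [freeSheafMap, freeSheafMap, freeSheafMap, ← Functor.map_comp, ← Functor.whiskerRight_comp,
    ← Functor.map_comp]

lemma restrictExt_apply (i : V ≤ W) (x : Ext.{u} (freeSheaf W) F n) :
    restrictExt i x = (Ext.mk₀ (freeSheafMap (homOfLE i))).comp x (zero_add n) := rfl

lemma restrictExt_restrictExt {U : Y.Opens} (i : U ≤ V) (j : V ≤ W)
    (x : Ext.{u} (freeSheaf W) F n) :
    restrictExt i (restrictExt j x) = restrictExt (i.trans j) x := by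
  simp only [restrictExt_apply, Ext.mk₀_comp_mk₀_assoc, freeSheafMap_comp]
  rfl

lemma restrictExt_refl (x : Ext.{u} (freeSheaf W) F n) : restrictExt le_rfl x = x := by
  have : freeSheafMap (homOfLE (le_refl W)) = 𝟙 (freeSheaf W) := by
    rw [freeSheafMap, show homOfLE (le_refl W) = 𝟙 W from rfl, CategoryTheory.Functor.map_id]
    exact (congrArg _ (Functor.whiskerRight_id _)).trans (CategoryTheory.Functor.map_id _ _)
  rw [restrictExt_apply, this, Ext.mk₀_id_comp]

lemma restrictExt_comp (i : V ≤ W) {m k : ℕ} (x : Ext.{u} (freeSheaf W) F n) (e : Ext.{u} F G m)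
    (h : n + m = k) : restrictExt i (x.comp e h) = (restrictExt i x).comp e h := by
  rw [restrictExt_apply, restrictExt_apply, Ext.comp_assoc _ _ _ (zero_add n) h (by omega)]

lemma restrictExt_mk₀ (i : V ≤ W) (s : freeSheaf W ⟶ F) :
    restrictExt i (Ext.mk₀ s) = Ext.mk₀ (freeSheafMap (homOfLE i) ≫ s) := by
  rw [restrictExt_apply, Ext.mk₀_comp_mk₀]

end

/-- Cohomology classes of positive degree vanish locally. -/
lemma exists_restrictExt_eq_zero {F : SmallSheaf Y} {n : ℕ} {W : Y.Opens}
    (x : Ext.{u} (freeSheaf W) F (n + 1)) {y : Y} (hy : y ∈ W) :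
    ∃ (V : Y.Opens) (i : V ≤ W), y ∈ V ∧ restrictExt i x = 0 := by
  induction n generalizing F with
  | zero =>
    obtain ⟨S, rfl, hI, hS⟩ := Ext.exists_shortExact_injective F
    obtain ⟨x', rfl⟩ := Ext.exists_comp_extClass_of_injective hS hI x
    obtain ⟨s, rfl⟩ := (Ext.mk₀_bijective _ _).2 x'
    have hepi : Epi S.g := hS.epi_g
    have hloc := (TopCat.Presheaf.isLocallySurjective_iff (X := Y.toTopCat) _).1
      ((TopCat.Sheaf.isLocallySurjective_iff_epi (X := Y.toTopCat) S.g).2 hepi)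
    obtain ⟨V, i, ⟨t, ht⟩, hyV⟩ := hloc W (freeSheafHomEquiv W _ s) y hy
    refine ⟨V, i, hyV, ?_⟩
    have : freeSheafMap (homOfLE i) ≫ s = (freeSheafHomEquiv V _).symm t ≫ S.g := by
      apply (freeSheafHomEquiv V _).injective
      rw [freeSheafHomEquiv_map, freeSheafHomEquiv_comp, Equiv.apply_symm_apply]
      exact ht.symm
    rw [restrictExt_comp, restrictExt_mk₀, this, ← Ext.mk₀_comp_mk₀,
      Ext.comp_assoc_of_second_deg_zero, hS.comp_extClass, Ext.comp_zero]
  | succ n ih =>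
    obtain ⟨S, rfl, hI, hS⟩ := Ext.exists_shortExact_injective F
    obtain ⟨x', rfl⟩ := Ext.exists_comp_extClass_of_injective hS hI x
    obtain ⟨V, i, hyV, h0⟩ := ih x'
    exact ⟨V, i, hyV, by rw [restrictExt_comp, h0, Ext.zero_comp]⟩

/-- The short exact sequence `0 ⟶ ℤ[U₁ ⊓ U₂] ⟶ ℤ[U₁] ⊞ ℤ[U₂] ⟶ ℤ[U₁ ⊔ U₂] ⟶ 0`. -/
lemma freeSheaf_shortExact (U₁ U₂ : Y.Opens) :
    ∃ z, (ShortComplex.mk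
      (biprod.lift (freeSheafMap (homOfLE (inf_le_left : U₁ ⊓ U₂ ≤ U₁)))
        (-freeSheafMap (homOfLE (inf_le_right : U₁ ⊓ U₂ ≤ U₂))))
      (biprod.desc (freeSheafMap (homOfLE (le_sup_left : U₁ ≤ U₁ ⊔ U₂)))
        (freeSheafMap (homOfLE (le_sup_right : U₂ ≤ U₁ ⊔ U₂)))) z).ShortExact :=
  ⟨_, (Opens.mayerVietorisSquare U₁ U₂).shortComplex_shortExact⟩

/-- A consequence of the Mayer-Vietoris sequence. -/
lemma eq_zero_of_restrictExt_eq_zero {F : SmallSheaf Y} {n : ℕ} {W U₁ U₂ : Y.Opens}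
    (hW : W = U₁ ⊔ U₂) (h₁ : U₁ ≤ W) (h₂ : U₂ ≤ W) (x : Ext.{u} (freeSheaf W) F (n + 1))
    (hx₁ : restrictExt h₁ x = 0) (hx₂ : restrictExt h₂ x = 0)
    (hs : ∀ z : Ext.{u} (freeSheaf (U₁ ⊓ U₂)) F n, ∃ (a : Ext.{u} (freeSheaf U₁) F n)
      (b : Ext.{u} (freeSheaf U₂) F n),
      restrictExt inf_le_left a + restrictExt inf_le_right b = z) : x = 0 := by
  subst hW
  obtain ⟨w, hS⟩ := freeSheaf_shortExact U₁ U₂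
  have h0 : (Ext.mk₀ (biprod.desc (freeSheafMap (homOfLE (le_sup_left : U₁ ≤ U₁ ⊔ U₂)))
        (freeSheafMap (homOfLE (le_sup_right : U₂ ≤ U₁ ⊔ U₂))))).comp x (zero_add (n + 1)) = 0 := by
    apply Ext.biprod_ext
    · rw [Ext.mk₀_comp_mk₀_assoc, biprod.inl_desc, Ext.comp_zero]
      exact hx₁
    · rw [Ext.mk₀_comp_mk₀_assoc, biprod.inr_desc, Ext.comp_zero]
      exact hx₂
  obtain ⟨z, rfl⟩ := Ext.contravariant_sequence_exact₃ hS F x h0 (add_comm 1 n)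
  obtain ⟨a, b, hab⟩ := hs z
  have hz : z = (Ext.mk₀ (biprod.lift (freeSheafMap (homOfLE (inf_le_left : U₁ ⊓ U₂ ≤ U₁)))
        (-freeSheafMap (homOfLE (inf_le_right : U₁ ⊓ U₂ ≤ U₂))))).comp
      ((Ext.mk₀ biprod.fst).comp a (zero_add n) - (Ext.mk₀ biprod.snd).comp b (zero_add n))
        (zero_add n) := by
    rw [← hab, restrictExt_apply, restrictExt_apply, sub_eq_add_neg, Ext.comp_add, Ext.comp_neg,
      Ext.mk₀_comp_mk₀_assoc, Ext.mk₀_comp_mk₀_assoc, biprod.lift_fst, biprod.lift_snd,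
      Ext.mk₀_neg, Ext.neg_comp, neg_neg]
  rw [hz]
  exact hS.extClass_comp_assoc _

instance subsingleton_ext_freeSheaf_bot (F : SmallSheaf Y) (n : ℕ) :
    Subsingleton (Ext.{u} (freeSheaf (⊥ : Y.Opens)) F n) := by
  have hF (G : SmallSheaf Y) : Subsingleton (G.obj.obj (op (⊥ : Y.Opens))) := by
    have := TopCat.Sheaf.isTerminalOfEmpty (X := Y.toTopCat) G
    exact AddCommGrpCat.subsingleton_of_isZero (this.isZero)
  refine subsingleton_of_forall_eq 0 fun x => ?_
  have : 𝟙 (freeSheaf (⊥ : Y.Opens)) = 0 := (freeSheafHomEquiv ⊥ _).injective (Subsingleton.elim _ _)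
  rw [← Ext.mk₀_id_comp x, this, Ext.mk₀_zero, Ext.zero_comp]

lemma freeSheafHomEquiv_add {V : Y.Opens} {F : SmallSheaf Y} (s t : freeSheaf V ⟶ F) :
    freeSheafHomEquiv V F (s + t) = freeSheafHomEquiv V F s + freeSheafHomEquiv V F t := by
  have h := freeSheafHomEquiv_comp (𝟙 (freeSheaf V)) (s + t)
  have h1 := freeSheafHomEquiv_comp (𝟙 (freeSheaf V)) s
  have h2 := freeSheafHomEquiv_comp (𝟙 (freeSheaf V)) t
  rw [Category.id_comp] at h h1 h2
  rw [h, h1, h2]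
  rfl

lemma basicOpen_add_le {V : Y.Opens} (f g : Γ(Y, V)) :
    Y.basicOpen (f + g) ≤ Y.basicOpen f ⊔ Y.basicOpen g := by
  intro y hy
  obtain ⟨hyV, hu⟩ := (Scheme.mem_basicOpen'' Y _ y).1 hy
  rw [map_add] at hu
  rcases IsLocalRing.isUnit_or_isUnit_of_isUnit_add hu with h | h
  · exact Or.inl ((Scheme.mem_basicOpen'' Y _ y).2 ⟨hyV, h⟩)
  · exact Or.inr ((Scheme.mem_basicOpen'' Y _ y).2 ⟨hyV, h⟩)

/-- Let `𝓑` be a class of affine opens stable under passing to basic opens. If the Čech cohomology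
in degree one of `F` vanishes for all coverings of members of `𝓑` by two basic opens, then the
members of `𝓑` are acyclic for `F`. -/
theorem subsingleton_ext_of_cech (F : SmallSheaf Y) (𝓑 : Set Y.Opens)
    (haff : ∀ V ∈ 𝓑, IsAffineOpen V) (hbasic : ∀ V ∈ 𝓑, ∀ f : Γ(Y, V), Y.basicOpen f ∈ 𝓑)
    (hc : ∀ V ∈ 𝓑, ∀ f g : Γ(Y, V), Y.basicOpen f ⊔ Y.basicOpen g = V →
      ∀ z : F.obj.obj (op (Y.basicOpen f ⊓ Y.basicOpen g)),
        ∃ (a : F.obj.obj (op (Y.basicOpen f))) (b : F.obj.obj (op (Y.basicOpen g))),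
          F.obj.map (homOfLE inf_le_left).op a + F.obj.map (homOfLE inf_le_right).op b = z)
    (V : Y.Opens) (hV : V ∈ 𝓑) (n : ℕ) : Subsingleton (Ext.{u} (freeSheaf V) F (n + 1)) := by
  induction n using Nat.strong_induction_on generalizing V with
  | _ n ih =>
  have hs : ∀ V ∈ 𝓑, ∀ f g : Γ(Y, V), Y.basicOpen f ⊔ Y.basicOpen g = V →
      ∀ z : Ext.{u} (freeSheaf (Y.basicOpen f ⊓ Y.basicOpen g)) F n,
        ∃ (a : Ext.{u} (freeSheaf (Y.basicOpen f)) F n)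
          (b : Ext.{u} (freeSheaf (Y.basicOpen g)) F n), restrictExt inf_le_left a + restrictExt inf_le_right b = z := by
    intro V hV f g hfg z
    cases n with
    | zero =>
      obtain ⟨s, rfl⟩ := (Ext.mk₀_bijective _ _).2 z
      obtain ⟨a, b, hab⟩ := hc V hV f g hfg (freeSheafHomEquiv _ _ s)
      refine ⟨Ext.mk₀ ((freeSheafHomEquiv _ _).symm a), Ext.mk₀ ((freeSheafHomEquiv _ _).symm b), ?_⟩
      rw [restrictExt_mk₀, restrictExt_mk₀, ← Ext.mk₀_add]
      congr 1
      apply (freeSheafHomEquiv _ _).injective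
      rw [← hab, freeSheafHomEquiv_add, freeSheafHomEquiv_map, freeSheafHomEquiv_map,
        Equiv.apply_symm_apply, Equiv.apply_symm_apply]
    | succ m =>
      have := ih m (by omega) _ (hbasic V hV (f * g))
      rw [Scheme.basicOpen_mul] at this
      exact ⟨0, 0, Subsingleton.elim _ _⟩
  refine subsingleton_of_forall_eq 0 fun x => ?_
  have hspan : Ideal.span {f : Γ(Y, V) | restrictExt (Y.basicOpen_le f) x = 0} = ⊤ := by
    rw [← (haff V hV).self_le_iSup_basicOpen_iff]
    intro y hy
    obtain ⟨W, i, hyW, h0⟩ := exists_restrictExt_eq_zero x hy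
    obtain ⟨f, hfW, hyf⟩ := (haff V hV).exists_basicOpen_le ⟨y, hyW⟩ hy
    refine Opens.mem_iSup.2 ⟨⟨f, ?_⟩, hyf⟩
    have := restrictExt_restrictExt hfW i x
    rw [h0, map_zero] at this
    exact this.symm
  have hall (f : Γ(Y, V)) (hf : f ∈ Ideal.span
      {f : Γ(Y, V) | restrictExt (Y.basicOpen_le f) x = 0}) :
      restrictExt (Y.basicOpen_le f) x = 0 := by
    induction hf using Submodule.span_induction with
    | mem f hf => exact hf
    | zero =>
      have : Subsingleton (Ext.{u} (freeSheaf (Y.basicOpen (0 : Γ(Y, V)))) F (n + 1)) := by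
        rw [Scheme.basicOpen_zero]; infer_instance
      exact Subsingleton.elim _ _
    | smul r f _ hf =>
      have hle : Y.basicOpen (r • f) ≤ Y.basicOpen f := by
        rw [smul_eq_mul, Scheme.basicOpen_mul]; exact inf_le_right
      rw [← restrictExt_restrictExt hle (Y.basicOpen_le f), hf, map_zero]
    | add f g _ _ hf hg =>
      let W := Y.basicOpen (f + g)
      let ρ := Y.presheaf.map (homOfLE (Y.basicOpen_le (f + g))).op
      have h₁ : Y.basicOpen (ρ f) = W ⊓ Y.basicOpen f := Scheme.basicOpen_res _ _ _
      have h₂ : Y.basicOpen (ρ g) = W ⊓ Y.basicOpen g := Scheme.basicOpen_res _ _ _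
      have hW : Y.basicOpen (ρ f) ⊔ Y.basicOpen (ρ g) = W := by
        rw [h₁, h₂, ← inf_sup_left]
        exact inf_eq_left.2 (basicOpen_add_le f g)
      have l₁ : Y.basicOpen (ρ f) ≤ Y.basicOpen f := h₁.trans_le inf_le_right
      have l₂ : Y.basicOpen (ρ g) ≤ Y.basicOpen g := h₂.trans_le inf_le_right
      refine eq_zero_of_restrictExt_eq_zero hW.symm (Y.basicOpen_le _) (Y.basicOpen_le _) _ ?_ ?_
        (hs W (hbasic V hV _) _ _ hW)
      · rw [restrictExt_restrictExt, ← restrictExt_restrictExt l₁ (Y.basicOpen_le f), hf, map_zero]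
      · rw [restrictExt_restrictExt, ← restrictExt_restrictExt l₂ (Y.basicOpen_le g), hg, map_zero]
  have h1 := hall 1 (hspan ▸ Submodule.mem_top)
  have hle : V ≤ Y.basicOpen (1 : Γ(Y, V)) := (Scheme.basicOpen_of_isUnit _ isUnit_one).ge
  rw [← restrictExt_refl x, ← restrictExt_restrictExt hle (Y.basicOpen_le 1), h1, map_zero]

end DeformationCohomology

namespace DeformationCohomology

section PowerSeries

variable {B C : Type*} [CommRing B] [CommRing C] {d : ℕ}

/-- The ideal `(x_1, …, x_d)` of the power series ring. -/
abbrev varsIdeal (B : Type*) [CommRing B] (d : ℕ) : Ideal (MvPowerSeries (Fin d) B) :=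
  Ideal.span (Set.range MvPowerSeries.X)

lemma exists_powerSeries_hom (φ : B →+* C) (a : Fin d → C) (ha : ∀ i, IsNilpotent (a i)) :
    ∃ Φ : MvPowerSeries (Fin d) B →+* C, Φ.comp MvPowerSeries.C = φ ∧
      (∀ i, Φ (MvPowerSeries.X i) = a i) ∧ ∃ n, ∀ s ∈ varsIdeal B d ^ n, Φ s = 0 := by
  obtain ⟨n, hn⟩ : IsNilpotent (Ideal.span (Set.range a)) := by
    classical
    rw [Ideal.FG.isNilpotent_iff_le_nilradical ⟨Finset.univ.image a, by simp⟩, Ideal.span_le]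
    rintro _ ⟨i, rfl⟩
    exact ha i
  have hmap : ∀ p ∈ MvPolynomial.idealOfVars (Fin d) B ^ n, MvPolynomial.eval₂Hom φ a p = 0 := by
    intro p hp
    have := Ideal.mem_map_of_mem (MvPolynomial.eval₂Hom φ a) hp
    rw [Ideal.map_pow, MvPolynomial.idealOfVars, Ideal.map_span, ← Set.range_comp] at this
    have hr : (MvPolynomial.eval₂Hom φ a) ∘ MvPolynomial.X = a := by
      funext i; simp
    rw [hr, hn] at this
    simpa using this
  let Φ : MvPowerSeries (Fin d) B →+* C :=
    (Ideal.Quotient.lift _ (MvPolynomial.eval₂Hom φ a) hmap).comp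
      (MvPowerSeries.truncTotalAlgHom (Fin d) B n : MvPowerSeries (Fin d) B →+* _)
  have hcoe (p : MvPolynomial (Fin d) B) : Φ (p : MvPowerSeries (Fin d) B) =
      MvPolynomial.eval₂Hom φ a p := by
    have := (MvPowerSeries.truncTotalAlgHom (Fin d) B n).commutes p
    have h2 : algebraMap (MvPolynomial (Fin d) B) (MvPowerSeries (Fin d) B) p = p := by
      simp [MvPowerSeries.algebraMap_apply']
    rw [h2] at this
    simp only [Φ, RingHom.comp_apply]
    erw [this]
    exact Ideal.Quotient.lift_mk _ _ _
  have hX (i : Fin d) : Φ (MvPowerSeries.X i) = a i := by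
    rw [← MvPolynomial.coe_X, hcoe]; simp
  refine ⟨Φ, ?_, hX, n, fun s hs => ?_⟩
  · ext b
    rw [RingHom.comp_apply, ← MvPolynomial.coe_C, hcoe]; simp
  · have := Ideal.mem_map_of_mem Φ hs
    rw [Ideal.map_pow, Ideal.map_span, ← Set.range_comp] at this
    rw [show Φ ∘ MvPowerSeries.X = a from funext hX, hn] at this
    simpa using this

lemma sub_C_constantCoeff_mem (s : MvPowerSeries (Fin d) B) :
    s - MvPowerSeries.C (MvPowerSeries.constantCoeff s) ∈ varsIdeal B d := by
  classical
  let t (i : Fin d) : MvPowerSeries (Fin d) B := fun m =>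
    if ∀ j < i, m j = 0 then MvPowerSeries.coeff (m + Finsupp.single i 1) s else 0
  have ht (i : Fin d) (m : Fin d →₀ ℕ) : MvPowerSeries.coeff m (t i) =
    if ∀ j < i, m j = 0 then MvPowerSeries.coeff (m + Finsupp.single i 1) s else 0 := rfl
  have : s - MvPowerSeries.C (MvPowerSeries.constantCoeff s) =
      ∑ i, MvPowerSeries.X i * t i := by
    ext m
    rw [map_sum, map_sub, MvPowerSeries.coeff_C]
    have hterm (i : Fin d) : MvPowerSeries.coeff m (MvPowerSeries.X i * t i) =
        if m i ≠ 0 ∧ ∀ j < i, m j = 0 then MvPowerSeries.coeff m s else 0 := by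
      rw [MvPowerSeries.X, MvPowerSeries.coeff_monomial_mul, one_mul, ht]
      by_cases hi : m i = 0
      · rw [if_neg, if_neg (by tauto)]
        intro h
        have := h i
        simp [hi] at this
      · have hle : Finsupp.single i 1 ≤ m := by
          intro j
          by_cases hj : i = j
          · subst hj; simp; omega
          · simp [hj]
        rw [if_pos hle, tsub_add_cancel_of_le hle]
        have hiff : (∀ j < i, (m - Finsupp.single i 1 : Fin d →₀ ℕ) j = 0) ↔ ∀ j < i, m j = 0 := by
          refine forall₂_congr fun j hj => ?_
          rw [Finsupp.tsub_apply, Finsupp.single_eq_of_ne hj.ne, tsub_zero]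
        rw [if_congr hiff rfl rfl, if_congr (and_iff_right hi) rfl rfl]
    rw [Finset.sum_congr rfl fun i _ => hterm i]
    by_cases hm : m = 0
    · subst hm; simp
    · have hne : (Finset.univ.filter fun i => m i ≠ 0).Nonempty := by
        obtain ⟨i, hi⟩ := Finsupp.ne_iff.1 hm
        exact ⟨i, by simpa using hi⟩
      let i₀ := (Finset.univ.filter fun i => m i ≠ 0).min' hne
      have hi₀ : m i₀ ≠ 0 := by
        have := Finset.min'_mem _ hne
        simpa using this
      have hmin (j : Fin d) (hj : m j ≠ 0) : i₀ ≤ j := Finset.min'_le _ _ (by simpa using hj)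
      rw [if_neg hm, sub_zero, Finset.sum_eq_single i₀, if_pos]
      · exact ⟨hi₀, fun j hj => by_contra fun h => absurd (hmin j h) (not_le.2 hj)⟩
      · intro i _ hi
        rw [if_neg]
        rintro ⟨h1, h2⟩
        exact hi₀ (h2 i₀ (lt_of_le_of_ne (hmin i h1) hi.symm))
      · simp
  rw [this]
  exact Ideal.sum_mem _ fun i _ => Ideal.mul_mem_right _ _ (Ideal.subset_span ⟨i, rfl⟩)

open scoped Pointwise in
lemma powerSeries_hom_ext {Φ Ψ : MvPowerSeries (Fin d) B →+* C}
    (hC : Φ.comp MvPowerSeries.C = Ψ.comp MvPowerSeries.C)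
    (hX : ∀ i, Φ (MvPowerSeries.X i) = Ψ (MvPowerSeries.X i)) {n : ℕ}
    (hΦ : ∀ s ∈ varsIdeal B d ^ n, Φ s = 0) (hΨ : ∀ s ∈ varsIdeal B d ^ n, Ψ s = 0) : Φ = Ψ := by
  have hmon (k : ℕ) (x) (hx : x ∈ (Set.range
      (MvPowerSeries.X : Fin d → MvPowerSeries (Fin d) B)) ^ k) : Φ x = Ψ x := by
    induction k generalizing x with
    | zero => rw [pow_zero, Set.mem_one] at hx; simp [hx]
    | succ k ih =>
      rw [pow_succ, Set.mem_mul] at hx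
      obtain ⟨y, hy, _, ⟨i, rfl⟩, rfl⟩ := hx
      rw [map_mul, map_mul, ih y hy, hX]
  have hpow (k : ℕ) : varsIdeal B d ^ k = Ideal.span (Set.range MvPowerSeries.X ^ k) :=
    Submodule.span_pow _ _
  have key (k : ℕ) (hk : k ≤ n) : ∀ s ∈ varsIdeal B d ^ k, Φ s = Ψ s := by
    induction hk using Nat.decreasingInduction with
    | self => exact fun s hs => (hΦ s hs).trans (hΨ s hs).symm
    | of_succ k _ ih =>
      intro s hs
      have hs' := hs
      rw [hpow] at hs'
      suffices ∀ t, Φ (t * s) = Ψ (t * s) by simpa using this 1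
      clear hs
      induction hs' using Submodule.span_induction with
      | mem x hx =>
        intro t
        have h1 := ih ((t - MvPowerSeries.C (MvPowerSeries.constantCoeff t)) * x) (by
          rw [pow_succ']
          refine Ideal.mul_mem_mul (sub_C_constantCoeff_mem t) ?_
          rw [hpow]
          exact Ideal.subset_span hx)
        have h2 := DFunLike.congr_fun hC (MvPowerSeries.constantCoeff t)
        simp only [RingHom.comp_apply] at h2
        rw [map_mul, map_mul, map_sub, map_sub, hmon k x hx, h2, sub_mul, sub_mul,
          sub_left_inj] at h1
        rw [map_mul, map_mul, hmon k x hx, h1]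
      | zero => simp
      | add x y _ _ hx hy => intro t; rw [mul_add, map_add, map_add, hx, hy]
      | smul r x _ hx => intro t; rw [smul_eq_mul, ← mul_assoc, hx]
  ext s
  exact key 0 (Nat.zero_le n) s (by simp)

end PowerSeries

end DeformationCohomology

namespace DeformationCohomology

section Coordinates

variable {V : Scheme.{u}} {d : ℕ} {P : (Over V)ᵒᵖ ⥤ AddCommGrpCat.{u}}
  (e : P ⋙ forget AddCommGrpCat.{u} ≅ formalSpace V d)

/-- The coordinates of a point of a formal Lie group. -/
def coord {Z : Over V} (x : P.obj (op Z)) (i : Fin d) : Γ(Z.left, ⊤) :=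
  (e.hom.app (op Z) x).1 (MvPowerSeries.X i)

lemma coord_map {Z Z' : Over V} (h : Z' ⟶ Z) (x : P.obj (op Z)) (i : Fin d) :
    coord e (P.map h.op x) i = h.left.appTop (coord e x i) := by
  have := ConcreteCategory.congr_hom (e.hom.naturality h.op) x
  exact congrArg (fun t => t.1 (MvPowerSeries.X i)) this

lemma exists_pow_eq_zero {Z : Over V} [CompactSpace Z.left] (φ : (formalSpace V d).obj (op Z)) :
    ∃ n : ℕ, ∀ s ∈ varsIdeal Γ(V, ⊤) d ^ n, φ.1 s = 0 := by
  choose W hW n hn using φ.2.2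
  obtain ⟨t, ht⟩ := isCompact_univ.elim_finite_subcover (fun z => (W z : Set Z.left))
    (fun z => (W z).2) (fun z _ => Set.mem_iUnion.2 ⟨z, hW z⟩)
  refine ⟨t.sup n, fun s hs => ?_⟩
  refine TopCat.Sheaf.eq_of_locally_eq' Z.left.sheaf (fun z : t => W z) ⊤
    (fun z => homOfLE le_top) ?_ _ _ fun z => ?_
  · intro y _
    obtain ⟨z, hz, hy⟩ := Set.mem_iUnion₂.1 (ht (Set.mem_univ y))
    exact Opens.mem_iSup.2 ⟨⟨z, hz⟩, hy⟩
  · exact (hn z s (Ideal.pow_le_pow_right (Finset.le_sup z.2) hs)).trans (map_zero _).symm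

lemma coord_ext {Z : Over V} [CompactSpace Z.left] {x y : P.obj (op Z)}
    (h : ∀ i, coord e x i = coord e y i) : x = y := by
  obtain ⟨n, hn⟩ := exists_pow_eq_zero (e.hom.app (op Z) x)
  obtain ⟨m, hm⟩ := exists_pow_eq_zero (e.hom.app (op Z) y)
  apply (ConcreteCategory.bijective_of_isIso (e.hom.app (op Z))).1
  apply Subtype.ext
  refine powerSeries_hom_ext (n := max n m) ?_ h
    (fun s hs => hn s (Ideal.pow_le_pow_right (le_max_left _ _) hs))
    (fun s hs => hm s (Ideal.pow_le_pow_right (le_max_right _ _) hs))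
  exact (e.hom.app (op Z) x).2.1.trans (e.hom.app (op Z) y).2.1.symm

lemma exists_coord (Z : Over V) (a : Fin d → Γ(Z.left, ⊤)) (ha : ∀ i, IsNilpotent (a i)) :
    ∃ x : P.obj (op Z), ∀ i, coord e x i = a i := by
  obtain ⟨Φ, h1, h2, n, hn⟩ := exists_powerSeries_hom Z.hom.appTop.hom a ha
  refine ⟨e.inv.app (op Z) ⟨Φ, h1, fun z => ⟨⊤, trivial, n, fun s hs => by
    rw [hn s hs, map_zero]⟩⟩, fun i => ?_⟩
  rw [coord]
  have := ConcreteCategory.congr_hom (e.inv_hom_id_app (op Z))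
    ⟨Φ, h1, fun z => ⟨⊤, trivial, n, fun s hs => by rw [hn s hs, map_zero]⟩⟩
  exact (congrArg (fun t => t.1 (MvPowerSeries.X i)) this).trans (h2 i)

lemma coord_zero (h0 : ∀ i, coord e (0 : P.obj (op (Over.mk (𝟙 V)))) i = 0)
    (Z : Over V) (i : Fin d) : coord e (0 : P.obj (op Z)) i = 0 := by
  have := coord_map e (Over.mkIdTerminal.from Z) 0 i
  rwa [map_zero, h0, map_zero] at this

section Affine

variable {Z : Over V} [IsAffine Z.left] {D : CommRingCat.{u}}

/-- For an affine `V`-scheme `Z` and a `Γ(Z)`-algebra `D`, the `V`-scheme `Spec D`. -/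
def specOver (ψ : Γ(Z.left, ⊤) ⟶ D) : Over V :=
  Over.mk (Spec.map ψ ≫ Z.left.isoSpec.inv ≫ Z.hom)

/-- The structure morphism `Spec D ⟶ Z`. -/
def specOverToBase (ψ : Γ(Z.left, ⊤) ⟶ D) : specOver ψ ⟶ Z :=
  Over.homMk (Spec.map ψ ≫ Z.left.isoSpec.inv) (Category.assoc _ _ _)

/-- The section `Z ⟶ Spec D` given by a retraction `D ⟶ Γ(Z)`. -/
def specOverSection (ψ : Γ(Z.left, ⊤) ⟶ D) (χ : D ⟶ Γ(Z.left, ⊤)) (h : ψ ≫ χ = 𝟙 _) :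
    Z ⟶ specOver ψ :=
  Over.homMk (Z.left.isoSpec.hom ≫ Spec.map χ) (by
    dsimp only [specOver, Over.mk_hom]
    rw [Category.assoc, ← Spec.map_comp_assoc, h, Spec.map_id, Category.id_comp,
      Iso.hom_inv_id_assoc])

instance (ψ : Γ(Z.left, ⊤) ⟶ D) : CompactSpace (specOver ψ).left :=
  inferInstanceAs (CompactSpace (Spec D))

/-- Coordinates of points of `Spec D`. -/
def specCoord (ψ : Γ(Z.left, ⊤) ⟶ D) (x : P.obj (op (specOver ψ))) (i : Fin d) : D :=
  (Scheme.ΓSpecIso D).hom (coord e x i)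

lemma specOverToBase_appTop (ψ : Γ(Z.left, ⊤) ⟶ D) :
    (specOverToBase ψ).left.appTop ≫ (Scheme.ΓSpecIso D).hom = ψ := by
  change (Spec.map ψ ≫ Z.left.isoSpec.inv).appTop ≫ _ = _
  rw [Scheme.Hom.comp_appTop, Category.assoc, Scheme.ΓSpecIso_naturality,
    ← Scheme.toSpecΓ_appTop, ← Scheme.isoSpec_hom, ← Scheme.Hom.comp_appTop_assoc,
    Iso.hom_inv_id, Scheme.Hom.id_appTop, Category.id_comp]

lemma coord_section (ψ : Γ(Z.left, ⊤) ⟶ D) (χ : D ⟶ Γ(Z.left, ⊤)) (h : ψ ≫ χ = 𝟙 _)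
    (x : P.obj (op (specOver ψ))) (i : Fin d) :
    coord e (P.map (specOverSection ψ χ h).op x) i = χ (specCoord e ψ x i) := by
  rw [specCoord, coord_map]
  have : (specOverSection ψ χ h).left.appTop = (Scheme.ΓSpecIso D).hom ≫ χ := by
    change (Z.left.isoSpec.hom ≫ Spec.map χ).appTop = _
    rw [Scheme.Hom.comp_appTop, Scheme.isoSpec_hom, Scheme.toSpecΓ_appTop,
      Scheme.ΓSpecIso_naturality]
  exact ConcreteCategory.congr_hom this _

lemma exists_specCoord (ψ : Γ(Z.left, ⊤) ⟶ D) (a : Fin d → D) (ha : ∀ i, IsNilpotent (a i)) :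
    ∃ x : P.obj (op (specOver ψ)), ∀ i, specCoord e ψ x i = a i := by
  obtain ⟨x, hx⟩ := exists_coord e (specOver ψ) (fun i => (Scheme.ΓSpecIso D).inv (a i))
    (fun i => (ha i).map _)
  refine ⟨x, fun i => ?_⟩
  rw [specCoord, hx]
  exact ConcreteCategory.congr_hom (Scheme.ΓSpecIso D).inv_hom_id _

end Affine

/-- The fibre product `C ×_{C/M} C ×_{C/M} C`. -/
def tripleFibreProduct {C : Type*} [CommRing C] (M : Ideal C) : Subring (C × C × C) where
  carrier := {p | p.2.1 - p.1 ∈ M ∧ p.2.2 - p.1 ∈ M}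
  zero_mem' := by simp
  one_mem' := by simp
  add_mem' := by
    rintro p q ⟨h1, h2⟩ ⟨h3, h4⟩
    constructor
    · simpa [add_sub_add_comm] using M.add_mem h1 h3
    · simpa [add_sub_add_comm] using M.add_mem h2 h4
  neg_mem' := by
    rintro p ⟨h1, h2⟩
    constructor
    · simpa [neg_add_eq_sub] using M.neg_mem h1
    · simpa [neg_add_eq_sub] using M.neg_mem h2
  mul_mem' := by
    rintro p q ⟨h1, h2⟩ ⟨h3, h4⟩
    constructor
    · have := M.add_mem (M.mul_mem_right q.2.1 h1) (M.mul_mem_left p.1 h3)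
      convert this using 1
      simp only [Prod.fst_mul, Prod.snd_mul]; ring
    · have := M.add_mem (M.mul_mem_right q.2.2 h2) (M.mul_mem_left p.1 h4)
      convert this using 1
      simp only [Prod.fst_mul, Prod.snd_mul]; ring

/-- If `M` has square zero, `(c, c + m, c + n) ↦ c + m + n` is a ring homomorphism. -/
def tripleSum {C : Type*} [CommRing C] (M : Ideal C) (hM : ∀ a ∈ M, ∀ b ∈ M, a * b = 0) :
    tripleFibreProduct M →+* C where
  toFun p := p.1.2.1 + p.1.2.2 - p.1.1
  map_zero' := by simp
  map_one' := by simp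
  map_add' p q := by simp; ring
  map_mul' p q := by
    have h1 := hM _ p.2.1 _ q.2.2
    have h2 := hM _ p.2.2 _ q.2.1
    simp only [Subring.coe_mul, Prod.fst_mul, Prod.snd_mul]
    linear_combination -h1 - h2

/-- On points with coordinates in an ideal of square zero, the group law is additive. -/
lemma coord_add_of_sq_zero (h0 : ∀ i, coord e (0 : P.obj (op (Over.mk (𝟙 V)))) i = 0)
    {Z : Over V} [IsAffine Z.left] (M : Ideal Γ(Z.left, ⊤))
    (hM : ∀ a ∈ M, ∀ b ∈ M, a * b = 0) (x y : P.obj (op Z)) (hx : ∀ i, coord e x i ∈ M)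
    (hy : ∀ i, coord e y i ∈ M) (i : Fin d) :
    coord e (x + y) i = coord e x i + coord e y i := by
  let D : CommRingCat.{u} := CommRingCat.of (tripleFibreProduct M)
  let ψ : Γ(Z.left, ⊤) ⟶ D := CommRingCat.ofHom
    { toFun c := ⟨(c, c, c), by constructor <;> simp⟩
      map_zero' := rfl
      map_one' := rfl
      map_add' _ _ := rfl
      map_mul' _ _ := rfl }
  let p₀ : D ⟶ Γ(Z.left, ⊤) := CommRingCat.ofHom
    ((RingHom.fst _ _).comp (tripleFibreProduct M).subtype)
  let p₁ : D ⟶ Γ(Z.left, ⊤) := CommRingCat.ofHom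
    ((RingHom.fst _ _).comp ((RingHom.snd _ _).comp (tripleFibreProduct M).subtype))
  let p₂ : D ⟶ Γ(Z.left, ⊤) := CommRingCat.ofHom
    ((RingHom.snd _ _).comp ((RingHom.snd _ _).comp (tripleFibreProduct M).subtype))
  let s : D ⟶ Γ(Z.left, ⊤) := CommRingCat.ofHom (tripleSum M hM)
  have hp₀ : ψ ≫ p₀ = 𝟙 _ := rfl
  have hp₁ : ψ ≫ p₁ = 𝟙 _ := rfl
  have hp₂ : ψ ≫ p₂ = 𝟙 _ := rfl
  have hs : ψ ≫ s = 𝟙 _ := by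
    ext c
    exact add_sub_cancel_right c c
  let a (i : Fin d) : D := ⟨(0, coord e x i, 0), by simpa [tripleFibreProduct] using hx i⟩
  let b (i : Fin d) : D := ⟨(0, 0, coord e y i), by simpa [tripleFibreProduct] using hy i⟩
  obtain ⟨α, hα⟩ := exists_specCoord e ψ a fun i => ⟨2, by
    rw [sq]
    exact Subtype.ext (Prod.ext (zero_mul _) (Prod.ext (hM _ (hx i) _ (hx i)) (zero_mul _)))⟩
  obtain ⟨β, hβ⟩ := exists_specCoord e ψ b fun i => ⟨2, by
    rw [sq]
    exact Subtype.ext (Prod.ext (zero_mul _) (Prod.ext (zero_mul _) (hM _ (hy i) _ (hy i))))⟩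
  have hz (χ : D ⟶ Γ(Z.left, ⊤)) (h : ψ ≫ χ = 𝟙 _) (ξ : P.obj (op (specOver ψ)))
      (w : P.obj (op Z)) (hw : ∀ i, χ (specCoord e ψ ξ i) = coord e w i) :
      P.map (specOverSection ψ χ h).op ξ = w :=
    coord_ext e fun i => by rw [coord_section, hw]
  have h1 : ∀ j, p₀ (specCoord e ψ (α + β) j) = 0 := by
    intro j
    rw [← coord_section e ψ p₀ hp₀, map_add, hz p₀ hp₀ α 0, hz p₀ hp₀ β 0, add_zero,
      coord_zero e h0]
    · intro i; rw [hβ, coord_zero e h0]; rfl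
    · intro i; rw [hα, coord_zero e h0]; rfl
  have h2 : ∀ j, p₁ (specCoord e ψ (α + β) j) = coord e x j := by
    intro j
    rw [← coord_section e ψ p₁ hp₁, map_add, hz p₁ hp₁ α x, hz p₁ hp₁ β 0, add_zero]
    · intro i; rw [hβ, coord_zero e h0]; rfl
    · intro i; rw [hα]; rfl
  have h3 : ∀ j, p₂ (specCoord e ψ (α + β) j) = coord e y j := by
    intro j
    rw [← coord_section e ψ p₂ hp₂, map_add, hz p₂ hp₂ α 0, hz p₂ hp₂ β y, zero_add]
    · intro i; rw [hβ]; rfl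
    · intro i; rw [hα, coord_zero e h0]; rfl
  have h4 : P.map (specOverSection ψ s hs).op (α + β) = x + y := by
    rw [map_add, hz s hs α x, hz s hs β y]
    · intro i; rw [hβ]; change 0 + coord e y i - 0 = _; ring
    · intro i; rw [hα]; change coord e x i + 0 - 0 = _; ring
  rw [← h4, coord_section]
  change p₁ (specCoord e ψ (α + β) i) + p₂ (specCoord e ψ (α + β) i) -
    p₀ (specCoord e ψ (α + β) i) = _
  rw [h1, h2, h3, sub_zero]

end Coordinates

end DeformationCohomology

namespace DeformationCohomology

section Coordinates

variable {V : Scheme.{u}} {d : ℕ} {P : (Over V)ᵒᵖ ⥤ AddCommGrpCat.{u}}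
  (e : P ⋙ forget AddCommGrpCat.{u} ≅ formalSpace V d)

instance isAffine_specOver {Z : Over V} [IsAffine Z.left] {D : CommRingCat.{u}}
    (ψ : Γ(Z.left, ⊤) ⟶ D) : IsAffine (specOver ψ).left :=
  inferInstanceAs (IsAffine (Spec D))

lemma specOverToBase_appTop_eq_zero_iff {Z : Over V} [IsAffine Z.left] {D : CommRingCat.{u}}
    (ψ : Γ(Z.left, ⊤) ⟶ D) (a : Γ(Z.left, ⊤)) :
    (specOverToBase ψ).left.appTop a = 0 ↔ ψ a = 0 := by
  have h : ψ a = (Scheme.ΓSpecIso D).hom ((specOverToBase ψ).left.appTop a) :=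
    (ConcreteCategory.congr_hom (specOverToBase_appTop ψ) a).symm
  rw [h]
  refine ⟨fun h => ?_, fun h => ?_⟩
  · rw [h]; exact map_zero (Scheme.ΓSpecIso D).hom.hom
  · exact (ConcreteCategory.bijective_of_isIso (Scheme.ΓSpecIso D).hom).1
      (h.trans (map_zero (Scheme.ΓSpecIso D).hom.hom).symm)

/-- The group law is additive up to products of coordinates. -/
lemma coord_sub_sub_mem (h0 : ∀ i, coord e (0 : P.obj (op (Over.mk (𝟙 V)))) i = 0)
    {Z : Over V} [IsAffine Z.left] (I J : Ideal Γ(Z.left, ⊤)) (hIJ : I * I ≤ J)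
    (x y z : P.obj (op Z)) (hx : ∀ i, coord e x i ∈ I) (hy : ∀ i, coord e y i ∈ I)
    (hz : ∀ i, coord e z i - (coord e x i + coord e y i) ∈ J) (i : Fin d) :
    coord e (z - (x + y)) i ∈ J := by
  let ψ : Γ(Z.left, ⊤) ⟶ CommRingCat.of (Γ(Z.left, ⊤) ⧸ J) :=
    CommRingCat.ofHom (Ideal.Quotient.mk J)
  let ρ := (specOverToBase ψ).left.appTop
  have hρ (a : Γ(Z.left, ⊤)) : ρ a = 0 ↔ a ∈ J :=
    (specOverToBase_appTop_eq_zero_iff ψ a).trans Ideal.Quotient.eq_zero_iff_mem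
  have hM : ∀ a ∈ I.map ρ.hom, ∀ b ∈ I.map ρ.hom, a * b = 0 := by
    intro a ha b hb
    have := Ideal.mul_mem_mul ha hb
    rw [← Ideal.map_mul] at this
    have hle : (I * I).map ρ.hom ≤ ⊥ := by
      rw [Ideal.map_le_iff_le_comap]
      exact fun c hc => (hρ c).2 (hIJ hc)
    simpa using hle this
  have hxy : P.map (specOverToBase ψ).op z = P.map (specOverToBase ψ).op (x + y) := by
    refine coord_ext e fun i => ?_
    rw [map_add, coord_add_of_sq_zero e h0 (I.map ρ.hom) hM, coord_map, coord_map, coord_map,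
      ← sub_eq_zero, ← map_add, ← map_sub]
    · exact (hρ _).2 (hz i)
    · intro i; rw [coord_map]; exact Ideal.mem_map_of_mem ρ.hom (hx i)
    · intro i; rw [coord_map]; exact Ideal.mem_map_of_mem ρ.hom (hy i)
  have hsub : P.map (specOverToBase ψ).op (z - (x + y)) = 0 := by
    rw [map_sub, hxy, sub_self]
  rw [← hρ, ← coord_map, hsub, coord_zero e h0]

end Coordinates

/-- Coordinates on a sheaf of groups `E` over the open `U`: over `X`-schemes lying over `U`, points
of `E` are given by tuples of nilpotent functions, in a way which is natural and for which the group
law is additive up to products. -/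
structure ChartCoordinates {X : Scheme.{u}} (E : BigSheaf X) (U : X.Opens) where
  /-- The number of coordinates. -/
  dim : ℕ
  /-- The coordinates of a point. -/
  coord {Z : Over X} (hZ : Set.range Z.hom ⊆ U) (x : E.obj.obj (op Z)) (i : Fin dim) : Γ(Z.left, ⊤)
  map {Z Z' : Over X} (hZ : Set.range Z.hom ⊆ U) (hZ' : Set.range Z'.hom ⊆ U) (h : Z' ⟶ Z)
    (x : E.obj.obj (op Z)) (i : Fin dim) :
      coord hZ' (E.obj.map h.op x) i = h.left.appTop (coord hZ x i)
  ext {Z : Over X} [CompactSpace Z.left] (hZ : Set.range Z.hom ⊆ U) {x y : E.obj.obj (op Z)}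
    (h : ∀ i, coord hZ x i = coord hZ y i) : x = y
  exists_coord {Z : Over X} (hZ : Set.range Z.hom ⊆ U) (a : Fin dim → Γ(Z.left, ⊤))
    (ha : ∀ i, IsNilpotent (a i)) : ∃ x : E.obj.obj (op Z), ∀ i, coord hZ x i = a i
  zero {Z : Over X} (hZ : Set.range Z.hom ⊆ U) (i : Fin dim) :
    coord hZ (0 : E.obj.obj (op Z)) i = 0
  sub_sub_mem {Z : Over X} [IsAffine Z.left] (hZ : Set.range Z.hom ⊆ U)
    (I J : Ideal Γ(Z.left, ⊤)) (hIJ : I * I ≤ J)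
    (x y z : E.obj.obj (op Z)) (hx : ∀ i, coord hZ x i ∈ I) (hy : ∀ i, coord hZ y i ∈ I)
    (hz : ∀ i, coord hZ z i - (coord hZ x i + coord hZ y i) ∈ J) (i : Fin dim) :
    coord hZ (z - (x + y)) i ∈ J

section

variable {X : Scheme.{u}} {E : BigSheaf X} {U : X.Opens}

/-- An `X`-scheme lying over `U`, as a `U`-scheme. -/
def liftOver (Z : Over X) (hZ : Set.range Z.hom ⊆ U) : Over (U : Scheme.{u}) :=
  Over.mk (IsOpenImmersion.lift U.ι Z.hom (by rwa [Scheme.Opens.range_ι]))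

/-- An `X`-scheme lying over `U` is the `X`-scheme defined by the corresponding `U`-scheme. -/
def liftOverIso (Z : Over X) (hZ : Set.range Z.hom ⊆ U) :
    (Over.map U.ι).obj (liftOver Z hZ) ≅ Z :=
  Over.isoMk (Iso.refl _) ((Category.id_comp _).trans (IsOpenImmersion.lift_fac _ _ _).symm)

/-- Functoriality of `liftOver`. -/
def liftOverMap {Z Z' : Over X} (hZ : Set.range Z.hom ⊆ U) (hZ' : Set.range Z'.hom ⊆ U)
    (h : Z' ⟶ Z) : liftOver Z' hZ' ⟶ liftOver Z hZ :=
  Over.homMk h.left (by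
    rw [← cancel_mono U.ι]
    simp [liftOver, IsOpenImmersion.lift_fac])

lemma liftOverMap_comp {Z Z' : Over X} (hZ : Set.range Z.hom ⊆ U) (hZ' : Set.range Z'.hom ⊆ U)
    (h : Z' ⟶ Z) : (Over.map U.ι).map (liftOverMap hZ hZ' h) ≫ (liftOverIso Z hZ).hom =
      (liftOverIso Z' hZ').hom ≫ h := by
  ext1
  exact (Category.comp_id _).trans (Category.id_comp _).symm

/-- The coordinates given by an isomorphism with a formal affine space. -/
def ChartCoordinates.ofIso {d : ℕ}
    (e : (Over.map U.ι).op ⋙ E.obj ⋙ forget AddCommGrpCat.{u} ≅ formalSpace U d)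
    (h0 : ∀ i : Fin d, (e.hom.app (op (Over.mk (𝟙 (U : Scheme.{u}))))
        (0 : E.obj.obj (op ((Over.map U.ι).obj (Over.mk (𝟙 (U : Scheme.{u}))))))).1
          (MvPowerSeries.X i) = 0) : ChartCoordinates E U :=
  let P : (Over (U : Scheme.{u}))ᵒᵖ ⥤ AddCommGrpCat.{u} := (Over.map U.ι).op ⋙ E.obj
  let e' : P ⋙ forget AddCommGrpCat.{u} ≅ formalSpace U d := e
  have h0' : ∀ i, DeformationCohomology.coord e' (0 : P.obj (op (Over.mk (𝟙 (U : Scheme.{u}))))) i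
    = 0 := h0
  let lift {Z : Over X} (hZ : Set.range Z.hom ⊆ U) : E.obj.obj (op Z) ≅ P.obj (op (liftOver Z hZ)) :=
    E.obj.mapIso (liftOverIso Z hZ).op
  { dim := d
    coord := fun hZ x i => DeformationCohomology.coord e' ((lift hZ).hom x) i
    map := fun {Z Z'} hZ hZ' h x i => by
      refine Eq.trans ?_ (coord_map e' (liftOverMap hZ hZ' h) _ i)
      congr 1
      change (E.obj.map h.op ≫ E.obj.map (liftOverIso Z' hZ').hom.op) x =
        (E.obj.map (liftOverIso Z hZ).hom.op ≫
          E.obj.map ((Over.map U.ι).map (liftOverMap hZ hZ' h)).op) x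
      rw [← E.obj.map_comp, ← E.obj.map_comp, ← op_comp, ← op_comp, liftOverMap_comp]
    ext := fun {Z} _ hZ x y h => by
      have : CompactSpace (liftOver Z hZ).left := inferInstanceAs (CompactSpace Z.left)
      exact (ConcreteCategory.bijective_of_isIso (lift hZ).hom).1 (coord_ext e' h)
    exists_coord := fun {Z} hZ a ha => by
      obtain ⟨x, hx⟩ := DeformationCohomology.exists_coord e' (liftOver Z hZ) a ha
      obtain ⟨y, rfl⟩ := (ConcreteCategory.bijective_of_isIso (lift hZ).hom).2 x
      exact ⟨y, hx⟩
    zero := fun {Z} hZ i => by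
      rw [map_zero]
      exact coord_zero e' h0' _ i
    sub_sub_mem := fun {Z} _ hZ I J hIJ x y z hx hy hz i => by
      have : IsAffine (liftOver Z hZ).left := inferInstanceAs (IsAffine Z.left)
      rw [map_sub, map_add]
      exact coord_sub_sub_mem (Z := liftOver Z hZ) e' h0' I J hIJ ((lift hZ).hom x)
        ((lift hZ).hom y) ((lift hZ).hom z) hx hy hz i }

lemma IsFormalLieGroup.exists_chartCoordinates (hE : IsFormalLieGroup E) (x : X) :
    ∃ U : X.Opens, x ∈ U ∧ Nonempty (ChartCoordinates E U) := by
  obtain ⟨U, hx, -, d, e, h0⟩ := hE x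
  exact ⟨U, hx, ⟨.ofIso e h0⟩⟩

end

end DeformationCohomology

namespace DeformationCohomology

section Rings

open TensorProduct

lemma eq_zero_iff_mem_map_of_isPushout {A : Type u} [CommRing A] {C C' : CommRingCat.{u}}
    {a : CommRingCat.of A ⟶ C} (I : Ideal A) {c : C ⟶ C'} {b : CommRingCat.of (A ⧸ I) ⟶ C'}
    (h : IsPushout a (CommRingCat.ofHom (Ideal.Quotient.mk I)) c b) (x : C) :
    c x = 0 ↔ x ∈ I.map a.hom := by
  constructor
  · intro hx
    let b' : CommRingCat.of (A ⧸ I) ⟶ CommRingCat.of (C ⧸ I.map a.hom) :=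
      CommRingCat.ofHom (Ideal.quotientMap _ a.hom Ideal.le_comap_map)
    let q : C ⟶ CommRingCat.of (C ⧸ I.map a.hom) := CommRingCat.ofHom (Ideal.Quotient.mk _)
    have hw : a ≫ q = CommRingCat.ofHom (Ideal.Quotient.mk I) ≫ b' := by
      ext y; rfl
    have := ConcreteCategory.congr_hom (h.inl_desc q b' hw) x
    rw [CommRingCat.comp_apply, hx, map_zero] at this
    exact Ideal.Quotient.eq_zero_iff_mem.1 this.symm
  · intro hx
    have hle : I.map a.hom ≤ RingHom.ker c.hom := by
      rw [Ideal.map_le_iff_le_comap]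
      intro y hy
      have := ConcreteCategory.congr_hom h.w y
      rw [CommRingCat.comp_apply, CommRingCat.comp_apply] at this
      refine this.trans ?_
      rw [show (CommRingCat.ofHom (Ideal.Quotient.mk I)) y = 0 from
        Ideal.Quotient.eq_zero_iff_mem.2 hy, map_zero]
    exact hle hx

section

variable {N A C C' : Type u} [CommRing N] [CommRing A] [CommRing C] [CommRing C'] [Algebra N A]
  [Algebra N C] [Algebra N C'] [Algebra C C'] [Algebra A C'] [IsScalarTower N C C']
  [IsScalarTower N A C'] [Algebra.IsPushout N C A C'] (I : Ideal N)

lemma exists_tensor_of_mem_map (x : C) (hx : x ∈ I.map (algebraMap N C)) :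
    ∃ t : C ⊗[N] I, algebraMap C C' x =
      (Algebra.IsPushout.out (R := N) (S := C) (R' := A) (S' := C')).equiv
        (LinearMap.lTensor C ((Algebra.linearMap N A).comp (Submodule.subtype I)) t) ∧
      (t = 0 → x = 0) := by
  suffices ∃ t : C ⊗[N] I, algebraMap C C' x =
      (Algebra.IsPushout.out (R := N) (S := C) (R' := A) (S' := C')).equiv
        (LinearMap.lTensor C ((Algebra.linearMap N A).comp (Submodule.subtype I)) t) ∧
      x = TensorProduct.rid N C (LinearMap.lTensor C (Submodule.subtype I) t) by
    obtain ⟨t, h1, h2⟩ := this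
    exact ⟨t, h1, fun h => by rw [h2, h]; simp⟩
  induction hx using Submodule.span_induction with
  | mem x hx =>
    obtain ⟨n, hn, rfl⟩ := hx
    refine ⟨1 ⊗ₜ ⟨n, hn⟩, ?_, ?_⟩
    · simp [IsBaseChange.equiv_tmul, ← IsScalarTower.algebraMap_apply]
    · simp [Algebra.algebraMap_eq_smul_one]
  | zero => exact ⟨0, by simp, by simp⟩
  | add x y _ _ hx hy =>
    obtain ⟨t, h1, h2⟩ := hx
    obtain ⟨s, h3, h4⟩ := hy
    exact ⟨t + s, by rw [map_add, map_add, map_add, h1, h3], by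
      rw [map_add, map_add, ← h2, ← h4]⟩
  | smul r x _ hx =>
    obtain ⟨t, h1, h2⟩ := hx
    refine ⟨r • t, ?_, ?_⟩
    · have h : LinearMap.lTensor C ((Algebra.linearMap N A).comp (Submodule.subtype I)) (r • t) =
          r • LinearMap.lTensor C ((Algebra.linearMap N A).comp (Submodule.subtype I)) t :=
        map_smul (LinearMap.baseChange C ((Algebra.linearMap N A).comp (Submodule.subtype I))) r t
      rw [h, smul_eq_mul, map_mul, h1, ← Algebra.smul_def]
      exact (map_smul (Algebra.IsPushout.out (R := N) (S := C) (R' := A) (S' := C')).equiv r _).symm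
    · have h : LinearMap.lTensor C (Submodule.subtype I) (r • t) =
          r • LinearMap.lTensor C (Submodule.subtype I) t :=
        map_smul (LinearMap.baseChange C (Submodule.subtype I)) r t
      rw [h, h2]
      exact (map_smul (AlgebraTensorModule.rid N C C) r _).symm

lemma injOn_map_of_flat [Module.Flat N C]
    (hI : ∀ n ∈ I, algebraMap N A n = 0 → n = 0) (x : C) (hx : x ∈ I.map (algebraMap N C))
    (h0 : algebraMap C C' x = 0) : x = 0 := by
  obtain ⟨t, h1, h2⟩ := exists_tensor_of_mem_map (A := A) (C' := C') I x hx
  apply h2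
  have hinj : Function.Injective ((Algebra.linearMap N A).comp (Submodule.subtype I)) := by
    rw [injective_iff_map_eq_zero]
    rintro ⟨n, hn⟩ h
    exact Subtype.ext (hI n hn h)
  have := Module.Flat.lTensor_preserves_injective_linearMap (M := C) _ hinj
  apply this
  apply (Algebra.IsPushout.out (R := N) (S := C) (R' := A) (S' := C')).equiv.injective
  rw [← h1, h0, map_zero, map_zero]

lemma exists_mem_map_of_surjective (J : Ideal A) (hJ : ∀ j ∈ J, ∃ n ∈ I, algebraMap N A n = j)
    (hIJ : ∀ n ∈ I, algebraMap N A n ∈ J)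
    (y : C') (hy : y ∈ J.map (algebraMap A C')) :
    ∃ x ∈ I.map (algebraMap N C), algebraMap C C' x = y := by
  have hmul (x : C) (hx : x ∈ I.map (algebraMap N C)) (t : A) :
      ∃ x' ∈ I.map (algebraMap N C), algebraMap C C' x' = algebraMap A C' t * algebraMap C C' x := by
    induction hx using Submodule.span_induction with
    | mem x hx =>
      obtain ⟨n, hn, rfl⟩ := hx
      obtain ⟨m, hm, hmt⟩ := hJ _ (J.mul_mem_left t (hIJ n hn))
      refine ⟨algebraMap N C m, Ideal.mem_map_of_mem _ hm, ?_⟩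
      rw [← IsScalarTower.algebraMap_apply, ← IsScalarTower.algebraMap_apply,
        IsScalarTower.algebraMap_apply N A C', hmt, map_mul, ← IsScalarTower.algebraMap_apply]
    | zero => exact ⟨0, Ideal.zero_mem _, by simp⟩
    | add x y _ _ hx hy =>
      obtain ⟨x', hx', h1⟩ := hx
      obtain ⟨y', hy', h2⟩ := hy
      exact ⟨x' + y', Ideal.add_mem _ hx' hy', by rw [map_add, map_add, mul_add, h1, h2]⟩
    | smul r x _ hx =>
      obtain ⟨x', hx', h1⟩ := hx
      exact ⟨r * x', Ideal.mul_mem_left _ _ hx', by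
        rw [smul_eq_mul, map_mul, map_mul, h1]; ring⟩
  induction hy using Submodule.span_induction with
  | mem y hy =>
    obtain ⟨j, hj, rfl⟩ := hy
    obtain ⟨n, hn, rfl⟩ := hJ j hj
    exact ⟨algebraMap N C n, Ideal.mem_map_of_mem _ hn, by
      rw [← IsScalarTower.algebraMap_apply, ← IsScalarTower.algebraMap_apply]⟩
  | zero => exact ⟨0, Ideal.zero_mem _, by simp⟩
  | add x y _ _ hx hy =>
    obtain ⟨x', hx', h1⟩ := hx
    obtain ⟨y', hy', h2⟩ := hy
    exact ⟨x' + y', Ideal.add_mem _ hx' hy', by rw [map_add, h1, h2]⟩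
  | smul r y _ hy =>
    obtain ⟨x, hx, rfl⟩ := hy
    obtain ⟨w, rfl⟩ :=
      (Algebra.IsPushout.out (R := N) (S := C) (R' := A) (S' := C')).equiv.surjective r
    induction w using TensorProduct.induction_on with
    | zero => exact ⟨0, Ideal.zero_mem _, by simp⟩
    | tmul s t =>
      obtain ⟨x', hx', h1⟩ := hmul x hx t
      refine ⟨s * x', Ideal.mul_mem_left _ _ hx', ?_⟩
      rw [IsBaseChange.equiv_tmul, map_mul, h1, smul_eq_mul, Algebra.smul_def, mul_assoc]
      rfl
    | add w v hw hv =>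
      obtain ⟨x', hx', h1⟩ := hw
      obtain ⟨y', hy', h2⟩ := hv
      exact ⟨x' + y', Ideal.add_mem _ hx' hy', by rw [map_add, h1, h2, map_add, add_smul]⟩

end

/-- Let `C' = C ⊗_N A` with `C` flat over `N`, and let `I ⊆ N` be an ideal mapped bijectively to an
ideal `J ⊆ A`. Then `I C → J C'` is bijective. -/
lemma map_ideal_bijective_of_isPushout {N A : Type u} [CommRing N] [CommRing A]
    {C C' : CommRingCat.{u}} {a : CommRingCat.of N ⟶ C} {θ : N →+* A}
    {c : C ⟶ C'} {b : CommRingCat.of A ⟶ C'} (h : IsPushout a (CommRingCat.ofHom θ) c b)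
    (ha : a.hom.Flat) (I : Ideal N) (J : Ideal A)
    (hI : ∀ n ∈ I, θ n = 0 → n = 0) (hJ : ∀ j ∈ J, ∃ n ∈ I, θ n = j) (hIJ : ∀ n ∈ I, θ n ∈ J) :
    (∀ x ∈ I.map a.hom, c x = 0 → x = 0) ∧ ∀ y ∈ J.map b.hom, ∃ x ∈ I.map a.hom, c x = y := by
  let _ := a.hom.toAlgebra
  let _ := θ.toAlgebra
  let _ := c.hom.toAlgebra
  let _ := b.hom.toAlgebra
  let _ := (a ≫ c).hom.toAlgebra
  have : IsScalarTower N C C' := .of_algebraMap_eq fun _ => rfl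
  have : IsScalarTower N A C' := .of_algebraMap_eq fun x =>
    (ConcreteCategory.congr_hom h.w x)
  have : Algebra.IsPushout N C A C' := CommRingCat.isPushout_iff_isPushout.1 h
  have : Module.Flat N C := ha
  exact ⟨fun x hx h0 => injOn_map_of_flat (A := A) (C' := C') I hI x hx h0,
    fun y hy => exists_mem_map_of_surjective (C := C) I J hJ hIJ y hy⟩

end Rings

end DeformationCohomology

namespace DeformationCohomology

section BaseChange

variable {R : Type u} [CommRing R] {X : Scheme.{u}} (f : X ⟶ Spec (.of R))
variable (A : Type u) [CommRing A] [Algebra R A] {B : Type u} [CommRing B] [Algebra R B]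

/-- The ring of functions on an open of `X_A` is an `A`-algebra. -/
def structureHom (W : (baseChange f A).Opens) : CommRingCat.of A ⟶ Γ(W, ⊤) :=
  (Scheme.ΓSpecIso (.of A)).inv ≫ (W.ι ≫ pullback.snd f _).appTop

/-- The ideal of functions on an open of `X_A` generated by the nilpotents of `A`. -/
def nilIdeal (k : ℕ) (W : (baseChange f A).Opens) : Ideal Γ(W, ⊤) :=
  (nilradical A ^ k).map (structureHom f A W).hom

lemma nilIdeal_one (W : (baseChange f A).Opens) :
    nilIdeal f A 1 W = (nilradical A).map (structureHom f A W).hom := by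
  rw [nilIdeal, pow_one]

lemma nilIdeal_mul (j k : ℕ) (W : (baseChange f A).Opens) :
    nilIdeal f A j W * nilIdeal f A k W = nilIdeal f A (j + k) W := by
  rw [nilIdeal, nilIdeal, nilIdeal, ← Ideal.map_mul, pow_add]

lemma nilIdeal_anti {j k : ℕ} (h : j ≤ k) (W : (baseChange f A).Opens) :
    nilIdeal f A k W ≤ nilIdeal f A j W :=
  Ideal.map_mono (Ideal.pow_le_pow_right h)

lemma isNilpotent_of_mem_nilIdeal {W : (baseChange f A).Opens} {a : Γ(W, ⊤)}
    (ha : a ∈ nilIdeal f A 1 W) : IsNilpotent a := by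
  have : nilIdeal f A 1 W ≤ nilradical Γ(W, ⊤) := by
    rw [nilIdeal, pow_one, Ideal.map_le_iff_le_comap]
    exact fun b hb => IsNilpotent.map hb (structureHom f A W).hom
  exact this ha

lemma structureHom_homOfLE {V W : (baseChange f A).Opens} (h : V ≤ W) :
    structureHom f A W ≫ ((baseChange f A).homOfLE h).appTop = structureHom f A V := by
  rw [structureHom, structureHom, Category.assoc, ← Scheme.Hom.comp_appTop,
    Scheme.homOfLE_ι_assoc]

lemma nilIdeal_map_homOfLE (k : ℕ) {V W : (baseChange f A).Opens} (h : V ≤ W) :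
    (nilIdeal f A k W).map ((baseChange f A).homOfLE h).appTop.hom = nilIdeal f A k V := by
  rw [nilIdeal, nilIdeal, Ideal.map_map, ← structureHom_homOfLE f A h]
  rfl

variable {A}

lemma isPullback_baseChangeMap (φ : A →ₐ[R] B) :
    IsPullback (baseChangeMap f φ) (pullback.snd f _) (pullback.snd f _)
      (Spec.map (CommRingCat.ofHom φ.toRingHom)) := by
  have h := IsPullback.of_hasPullback f (Spec.map (CommRingCat.ofHom (algebraMap R B)))
  refine IsPullback.of_right ?_ (pullback.lift_snd _ _ _)
    (IsPullback.of_hasPullback f (Spec.map (CommRingCat.ofHom (algebraMap R A))))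
  rw [← Spec.map_comp, ← CommRingCat.ofHom_comp]
  have e : φ.toRingHom.comp (algebraMap R A) = algebraMap R B := φ.comp_algebraMap
  rw [e, baseChangeMap_fst]
  exact h

instance (φ : A →ₐ[R] B) : IsAffineHom (baseChangeMap f φ) :=
  MorphismProperty.of_isPullback (isPullback_baseChangeMap f φ).flip inferInstance

lemma isPushout_structureHom (φ : A →ₐ[R] B) {W : (baseChange f A).Opens} (hW : IsAffineOpen W) :
    IsPushout (structureHom f A W) (CommRingCat.ofHom φ.toRingHom)
      (baseChangeMap f φ ∣_ W).appTop (structureHom f B (baseChangeMap f φ ⁻¹ᵁ W)) := by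
  have : IsAffine W := hW
  have h := isPushout_appTop_of_isPullback
    ((isPullback_morphismRestrict (baseChangeMap f φ) W).paste_vert
      (isPullback_baseChangeMap f φ))
  refine h.of_iso (Scheme.ΓSpecIso _) (Iso.refl _) (Scheme.ΓSpecIso _) (Iso.refl _) ?_ ?_ ?_ ?_
  · simp [structureHom]
  · simp
  · exact (Category.comp_id _).trans (Category.id_comp _).symm
  · simp [structureHom]

lemma flat_structureHom [Flat f] {W : (baseChange f A).Opens} (hW : IsAffineOpen W) :
    (structureHom f A W).hom.Flat := by
  have : IsAffine W := hW
  have h := (W.ι ≫ pullback.snd f _ : (W : Scheme.{u}) ⟶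
    Spec (CommRingCat.of A)).flat_appTop
  rw [structureHom, CommRingCat.hom_comp]
  exact RingHom.Flat.comp (.of_bijective (ConcreteCategory.bijective_of_isIso _)) h

/-- If `A → B` is bijective on nilradicals, so are the maps of ideals they generate on affine
opens. -/
lemma nilIdeal_bijective [Flat f] (φ : A →ₐ[R] B) (hinj : ∀ a ∈ nilradical A, φ a = 0 → a = 0)
    (hsurj : ∀ b ∈ nilradical B, ∃ a ∈ nilradical A, φ a = b)
    {W : (baseChange f A).Opens} (hW : IsAffineOpen W) :
    (∀ x ∈ nilIdeal f A 1 W, (baseChangeMap f φ ∣_ W).appTop x = 0 → x = 0) ∧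
    ∀ y ∈ nilIdeal f B 1 (baseChangeMap f φ ⁻¹ᵁ W), ∃ x ∈ nilIdeal f A 1 W,
        (baseChangeMap f φ ∣_ W).appTop x = y := by
  rw [nilIdeal_one f A, nilIdeal_one f B]
  exact map_ideal_bijective_of_isPushout (isPushout_structureHom f φ hW) (flat_structureHom f hW)
    (nilradical A) (nilradical B) hinj hsurj (fun n hn => IsNilpotent.map hn φ)

end BaseChange

section Localization

lemma exists_add_of_isLocalization {C Cf Cg Cfg : Type*} [CommRing C] [CommRing Cf] [CommRing Cg]
    [CommRing Cfg] [Algebra C Cf] [Algebra C Cg] [Algebra C Cfg] (f g : C)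
    [IsLocalization.Away f Cf] [IsLocalization.Away g Cg] [IsLocalization.Away (f * g) Cfg]
    (hfg : Ideal.span {f, g} = ⊤) (a : Cf →+* Cfg) (b : Cg →+* Cfg)
    (ha : a.comp (algebraMap C Cf) = algebraMap C Cfg)
    (hb : b.comp (algebraMap C Cg) = algebraMap C Cfg) (K : Ideal C) (z : Cfg)
    (hz : z ∈ K.map (algebraMap C Cfg)) :
    ∃ x ∈ K.map (algebraMap C Cf), ∃ y ∈ K.map (algebraMap C Cg), a x + b y = z := by
  obtain ⟨⟨⟨k, hk⟩, ⟨_, n, rfl⟩⟩, hkz⟩ :=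
    (IsLocalization.mem_map_algebraMap_iff (Submonoid.powers (f * g)) Cfg).1 hz
  dsimp only at hkz
  have hpow : Ideal.span {f ^ n, g ^ n} = ⊤ := by
    have := Ideal.span_pow_eq_top {f, g} hfg n
    rwa [Set.image_pair] at this
  obtain ⟨r, s, hrs⟩ := Ideal.mem_span_pair.1 ((Ideal.eq_top_iff_one _).1 hpow)
  have hu : IsUnit (algebraMap C Cfg (f * g)) := IsLocalization.Away.algebraMap_isUnit (f * g)
  rw [map_mul] at hu
  have huf := (isUnit_of_mul_isUnit_left hu).pow n
  have hug := (isUnit_of_mul_isUnit_right hu).pow n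
  have ha' (c : C) : a (algebraMap C Cf c) = algebraMap C Cfg c := RingHom.congr_fun ha c
  have hb' (c : C) : b (algebraMap C Cg c) = algebraMap C Cfg c := RingHom.congr_fun hb c
  let u : Submonoid.powers f := ⟨f ^ n, n, rfl⟩
  let v : Submonoid.powers g := ⟨g ^ n, n, rfl⟩
  refine ⟨IsLocalization.mk' Cf (s * k) u, ?_, IsLocalization.mk' Cg (r * k) v, ?_, ?_⟩
  · rw [IsLocalization.mk'_eq_mul_mk'_one]
    exact Ideal.mul_mem_right _ _ (Ideal.mem_map_of_mem _ (K.mul_mem_left s hk))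
  · rw [IsLocalization.mk'_eq_mul_mk'_one]
    exact Ideal.mul_mem_right _ _ (Ideal.mem_map_of_mem _ (K.mul_mem_left r hk))
  · have h1 : a (IsLocalization.mk' Cf (s * k) u) * algebraMap C Cfg f ^ n =
        algebraMap C Cfg (s * k) := by
      have := congrArg a (IsLocalization.mk'_spec Cf (s * k) u)
      rwa [map_mul, ha', ha', map_pow] at this
    have h2 : b (IsLocalization.mk' Cg (r * k) v) * algebraMap C Cfg g ^ n =
        algebraMap C Cfg (r * k) := by
      have := congrArg b (IsLocalization.mk'_spec Cg (r * k) v)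
      rwa [map_mul, hb', hb', map_pow] at this
    have h3 := congrArg (algebraMap C Cfg) hrs
    apply huf.mul_right_cancel
    apply hug.mul_right_cancel
    simp only [map_add, map_mul, map_pow, map_one] at h1 h2 h3 hkz
    set F := algebraMap C Cfg f ^ n
    set G := algebraMap C Cfg g ^ n
    set x := a (IsLocalization.mk' Cf (s * k) u)
    set y := b (IsLocalization.mk' Cg (r * k) v)
    set κ := algebraMap C Cfg k
    have h4 : z * (F * G) = κ := by rw [← hkz, mul_pow]
    linear_combination G * h1 + F * h2 + κ * h3 - h4

lemma exists_add_of_isLocalization_hom {C Cf Cg Cfg : CommRingCat.{u}} (cf : C ⟶ Cf) (cg : C ⟶ Cg)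
    (cfg : C ⟶ Cfg) (a : Cf ⟶ Cfg) (b : Cg ⟶ Cfg) (ha : cf ≫ a = cfg) (hb : cg ≫ b = cfg) (f g : C)
    (hcf : letI := cf.hom.toAlgebra; IsLocalization.Away f Cf)
    (hcg : letI := cg.hom.toAlgebra; IsLocalization.Away g Cg)
    (hcfg : letI := cfg.hom.toAlgebra; IsLocalization.Away (f * g) Cfg)
    (hfg : Ideal.span {f, g} = ⊤) (K : Ideal C) (z : Cfg) (hz : z ∈ K.map cfg.hom) :
    ∃ x ∈ K.map cf.hom, ∃ y ∈ K.map cg.hom, a x + b y = z := by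
  let _ := cf.hom.toAlgebra
  let _ := cg.hom.toAlgebra
  let _ := cfg.hom.toAlgebra
  exact exists_add_of_isLocalization f g hfg a.hom b.hom (congrArg CommRingCat.Hom.hom ha)
    (congrArg CommRingCat.Hom.hom hb) K z hz

lemma isLocalization_homOfLE {Y : Scheme.{u}} {V W : Y.Opens} (hV : IsAffineOpen V) (hWV : W ≤ V)
    (h : Γ(Y, V.ι ''ᵁ ⊤)) (hW : W = Y.basicOpen h) :
    letI := (Y.homOfLE hWV).appTop.hom.toAlgebra
    IsLocalization.Away (R := Γ(V, ⊤)) h Γ(W, ⊤) := by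
  have hVa : IsAffineOpen (V.ι ''ᵁ ⊤) := by
    rwa [Scheme.Opens.ι_image_top]
  have := hVa.isLocalization_of_eq_basicOpen h
    (homOfLE (Y.ι_image_homOfLE_le_ι_image hWV ⊤)) ((Scheme.Opens.ι_image_top W).trans hW)
  rw [Scheme.homOfLE_appTop]
  exact this

lemma exists_add_of_basicOpen {Y : Scheme.{u}} {V : Y.Opens} (hV : IsAffineOpen V) (f g : Γ(Y, V))
    (hfg : Y.basicOpen f ⊔ Y.basicOpen g = V) (K : Ideal Γ(V, ⊤))
    (z : Γ((Y.basicOpen f ⊓ Y.basicOpen g : Y.Opens), ⊤))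
    (hz : z ∈ K.map (Y.homOfLE (inf_le_left.trans (Y.basicOpen_le f))).appTop.hom) :
    ∃ x ∈ K.map (Y.homOfLE (Y.basicOpen_le f)).appTop.hom,
    ∃ y ∈ K.map (Y.homOfLE (Y.basicOpen_le g)).appTop.hom,
      (Y.homOfLE inf_le_left).appTop x + (Y.homOfLE inf_le_right).appTop y = z := by
  have hV' : V.ι ''ᵁ ⊤ = V := Scheme.Opens.ι_image_top V
  have hVa : IsAffineOpen (V.ι ''ᵁ ⊤) := by rwa [hV']
  let i : V.ι ''ᵁ ⊤ ⟶ V := homOfLE hV'.le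
  let f' : Γ(Y, V.ι ''ᵁ ⊤) := Y.presheaf.map i.op f
  let g' : Γ(Y, V.ι ''ᵁ ⊤) := Y.presheaf.map i.op g
  have hf' : Y.basicOpen f' = Y.basicOpen f := by
    rw [Y.basicOpen_res, hV', inf_eq_right]; exact Y.basicOpen_le f
  have hg' : Y.basicOpen g' = Y.basicOpen g := by
    rw [Y.basicOpen_res, hV', inf_eq_right]; exact Y.basicOpen_le g
  have hspan : Ideal.span {f', g'} = ⊤ := by
    rw [← hVa.self_le_iSup_basicOpen_iff]
    refine hV'.le.trans (hfg.ge.trans (sup_le ?_ ?_))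
    · exact hf'.ge.trans (le_iSup (fun t : ({f', g'} : Set Γ(Y, V.ι ''ᵁ ⊤)) => Y.basicOpen t.1)
        ⟨f', by simp⟩)
    · exact hg'.ge.trans (le_iSup (fun t : ({f', g'} : Set Γ(Y, V.ι ''ᵁ ⊤)) => Y.basicOpen t.1)
        ⟨g', by simp⟩)
  have hle : Y.basicOpen f ⊓ Y.basicOpen g ≤ V := inf_le_left.trans (Y.basicOpen_le f)
  refine exists_add_of_isLocalization_hom (C := Γ(V, ⊤)) _ _ _ _ _ ?_ ?_ f' g'
    (isLocalization_homOfLE hV (Y.basicOpen_le f) f' hf'.symm)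
    (isLocalization_homOfLE hV (Y.basicOpen_le g) g' hg'.symm)
    (isLocalization_homOfLE hV hle (f' * g') (by rw [Y.basicOpen_mul, hf', hg'])) hspan K z hz
  · rw [← Scheme.Hom.comp_appTop, Scheme.homOfLE_homOfLE]
  · rw [← Scheme.Hom.comp_appTop, Scheme.homOfLE_homOfLE]

end Localization

end DeformationCohomology

namespace DeformationCohomology

variable {R : Type u} [CommRing R] {X : Scheme.{u}} (f : X ⟶ Spec (.of R)) (E : BigSheaf X)
variable (A : Type u) [CommRing A] [Algebra R A] {B : Type u} [CommRing B] [Algebra R B]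

lemma range_opensOver_subset {Y : Scheme.{u}} {p : Y ⟶ X} {U : X.Opens} {W : Y.Opens}
    (hW : W ≤ p ⁻¹ᵁ U) : Set.range ((opensOver p).obj W).hom ⊆ U := by
  rintro _ ⟨z, rfl⟩
  exact hW z.2

section

variable {E} {U : X.Opens} (c : ChartCoordinates E U)

/-- The coordinates of a section of `E` over an open of an `X`-scheme `Y` lying over `U`. -/
def ChartCoordinates.openCoord {Y : Scheme.{u}} {p : Y ⟶ X} {W : Y.Opens} (hW : W ≤ p ⁻¹ᵁ U)
    (s : E.obj.obj (op ((opensOver p).obj W))) (i : Fin c.dim) : Γ(W, ⊤) :=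
  c.coord (range_opensOver_subset hW) s i

lemma ChartCoordinates.openCoord_preimageOver {Y Y' : Scheme.{u}} {p : Y ⟶ X} {p' : Y' ⟶ X}
    (h : Y' ⟶ Y) (w : h ≫ p = p') {W : Y.Opens} (hW : W ≤ p ⁻¹ᵁ U) (hW' : h ⁻¹ᵁ W ≤ p' ⁻¹ᵁ U)
    (s : E.obj.obj (op ((opensOver p).obj W))) (i : Fin c.dim) :
    c.openCoord hW' (E.obj.map (preimageOver h w W).op s) i =
      (h ∣_ W).appTop (c.openCoord hW s i) :=
  c.map _ _ (preimageOver h w W) s i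

lemma ChartCoordinates.openCoord_map {Y : Scheme.{u}} {p : Y ⟶ X} {V W : Y.Opens} (h : V ⟶ W)
    (hW : W ≤ p ⁻¹ᵁ U) (hV : V ≤ p ⁻¹ᵁ U)
    (s : E.obj.obj (op ((opensOver p).obj W))) (i : Fin c.dim) :
    c.openCoord hV (E.obj.map ((opensOver p).map h).op s) i =
      (Y.homOfLE h.le).appTop (c.openCoord hW s i) :=
  c.map _ _ ((opensOver p).map h) s i

lemma ChartCoordinates.openCoord_ext {Y : Scheme.{u}} {p : Y ⟶ X} {W : Y.Opens}
    (hWa : IsAffineOpen W) (hW : W ≤ p ⁻¹ᵁ U) {s t : E.obj.obj (op ((opensOver p).obj W))}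
    (h : ∀ i, c.openCoord hW s i = c.openCoord hW t i) : s = t := by
  have : CompactSpace ((opensOver p).obj W).left := isCompact_iff_compactSpace.1 hWa.isCompact
  exact c.ext _ h

lemma ChartCoordinates.openCoord_zero {Y : Scheme.{u}} {p : Y ⟶ X} {W : Y.Opens}
    (hW : W ≤ p ⁻¹ᵁ U) (i : Fin c.dim) :
    c.openCoord hW (0 : E.obj.obj (op ((opensOver p).obj W))) i = 0 :=
  c.zero _ i

lemma ChartCoordinates.exists_openCoord {Y : Scheme.{u}} {p : Y ⟶ X} {W : Y.Opens}
    (hW : W ≤ p ⁻¹ᵁ U) (a : Fin c.dim → Γ(W, ⊤)) (ha : ∀ i, IsNilpotent (a i)) :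
    ∃ s : E.obj.obj (op ((opensOver p).obj W)), ∀ i, c.openCoord hW s i = a i :=
  c.exists_coord (range_opensOver_subset hW) a ha

lemma ChartCoordinates.openCoord_sub_sub_mem {Y : Scheme.{u}} {p : Y ⟶ X} {W : Y.Opens}
    (hWa : IsAffineOpen W) (hW : W ≤ p ⁻¹ᵁ U) (I J : Ideal Γ(W, ⊤)) (hIJ : I * I ≤ J)
    (x y z : E.obj.obj (op ((opensOver p).obj W))) (hx : ∀ i, c.openCoord hW x i ∈ I)
    (hy : ∀ i, c.openCoord hW y i ∈ I)
    (hz : ∀ i, c.openCoord hW z i - (c.openCoord hW x i + c.openCoord hW y i) ∈ J)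
    (i : Fin c.dim) : c.openCoord hW (z - (x + y)) i ∈ J := by
  have : IsAffine ((opensOver p).obj W).left := hWa
  exact c.sub_sub_mem _ I J hIJ x y z hx hy hz i

lemma preimage_le_of_comp {Y Y' : Scheme.{u}} {p : Y ⟶ X} {p' : Y' ⟶ X}
    (h : Y' ⟶ Y) (w : h ≫ p = p') {W : Y.Opens} (hW : W ≤ p ⁻¹ᵁ U) : h ⁻¹ᵁ W ≤ p' ⁻¹ᵁ U := by
  subst w
  exact fun y hy => hW hy

lemma morphismRestrict_redInclusion_eq_zero_iff {W : (baseChange f A).Opens}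
    (hWa : IsAffineOpen W) (a : Γ(W, ⊤)) :
    (redInclusion f A ∣_ W).appTop a = 0 ↔ a ∈ nilIdeal f A 1 W := by
  have e : (Ideal.Quotient.mkₐ R (nilradical A)).toRingHom = Ideal.Quotient.mk (nilradical A) := rfl
  have h := isPushout_structureHom f (Ideal.Quotient.mkₐ R (nilradical A)) hWa
  rw [e] at h
  rw [nilIdeal_one]
  exact eq_zero_iff_mem_map_of_isPushout (nilradical A) h a

/-- A section of `E` over an affine open of `X_A` vanishes on the reduction if and only if its
coordinates are in the ideal generated by the nilpotents of `A`. -/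
lemma ChartCoordinates.map_redInclusion_eq_zero_iff {W : (baseChange f A).Opens}
    (hWa : IsAffineOpen W) (hW : W ≤ baseChangeFst f A ⁻¹ᵁ U)
    (s : E.obj.obj (op ((opensOver (baseChangeFst f A)).obj W))) :
    E.obj.map (preimageOver (redInclusion f A) (baseChangeMap_fst f _) W).op s = 0 ↔
      ∀ i, c.openCoord hW s i ∈ nilIdeal f A 1 W := by
  have hW' := preimage_le_of_comp (redInclusion f A) (baseChangeMap_fst f _) hW
  have key := morphismRestrict_redInclusion_eq_zero_iff f A hWa
  constructor
  · intro h i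
    rw [← key, ← c.openCoord_preimageOver (redInclusion f A) (baseChangeMap_fst f _) hW hW', h]
    exact c.openCoord_zero hW' i
  · intro h
    refine c.openCoord_ext (hWa.preimage (redInclusion f A)) hW' fun i => ?_
    rw [c.openCoord_preimageOver (redInclusion f A) (baseChangeMap_fst f _) hW hW',
      (key _).2 (h i)]
    exact (c.openCoord_zero hW' i).symm

end

/-- The inclusion of the sections of `Ẽ` in the sections of `E`. -/
def tildeInclusion (W : (baseChange f A).Opens) : (tildeSheaf f E A).obj.obj (op W) →+
    E.obj.obj (op ((opensOver (baseChangeFst f A)).obj W)) :=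
  ((tildeSheafι f E A).hom.app (op W)).hom

lemma tildeInclusion_map {V W : (baseChange f A).Opens} (i : V ⟶ W)
    (t : (tildeSheaf f E A).obj.obj (op W)) :
    tildeInclusion f E A V ((tildeSheaf f E A).obj.map i.op t) =
      E.obj.map ((opensOver (baseChangeFst f A)).map i).op (tildeInclusion f E A W t) :=
  ConcreteCategory.congr_hom ((tildeSheafι f E A).hom.naturality i.op) t

lemma tildeInclusion_map_redInclusion (W : (baseChange f A).Opens)
    (t : (tildeSheaf f E A).obj.obj (op W)) :
    E.obj.map (preimageOver (redInclusion f A) (baseChangeMap_fst f _) W).op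
      (tildeInclusion f E A W t) = 0 := by
  have h : (tildeSheafι f E A).hom.app (op W) ≫
      E.obj.map (preimageOver (redInclusion f A) (baseChangeMap_fst f _) W).op = 0 :=
    congrArg (fun t => t.hom.app (op W)) (kernel.condition (redRestriction f E A))
  exact ConcreteCategory.congr_hom h t

lemma tildeInclusion_injective (W : (baseChange f A).Opens) :
    Function.Injective (tildeInclusion f E A W) := by
  have : Mono (tildeSheafι f E A) := inferInstanceAs (Mono (kernel.ι _))
  intro s t (h : (tildeSheafι f E A).hom.app (op W) s = (tildeSheafι f E A).hom.app (op W) t)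
  obtain ⟨s, rfl⟩ := (freeSheafHomEquiv W _).surjective s
  obtain ⟨t, rfl⟩ := (freeSheafHomEquiv W _).surjective t
  rw [← freeSheafHomEquiv_comp, ← freeSheafHomEquiv_comp] at h
  rw [(cancel_mono _).1 ((freeSheafHomEquiv W _).injective h)]

lemma freeSheafHomEquiv_zero {Y : Scheme.{u}} (W : Y.Opens) (F : SmallSheaf Y) :
    freeSheafHomEquiv W F 0 = 0 := by
  have h := freeSheafHomEquiv_add (0 : freeSheaf W ⟶ F) 0
  rwa [add_zero, left_eq_add] at h

lemma exists_tildeInclusion_eq {W : (baseChange f A).Opens}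
    (s : E.obj.obj (op ((opensOver (baseChangeFst f A)).obj W)))
    (hs : E.obj.map (preimageOver (redInclusion f A) (baseChangeMap_fst f _) W).op s = 0) :
    ∃ t, tildeInclusion f E A W t = s := by
  let s' : (restrictSmall E (baseChangeFst f A)).obj.obj (op W) := s
  let g := (freeSheafHomEquiv W (restrictSmall E (baseChangeFst f A))).symm s'
  have hg : freeSheafHomEquiv W _ g = s' := Equiv.apply_symm_apply _ _
  have h0 : g ≫ redRestriction f E A = 0 := by
    apply (freeSheafHomEquiv W _).injective
    rw [freeSheafHomEquiv_comp, hg]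
    refine Eq.trans ?_ (freeSheafHomEquiv_zero W _).symm
    exact hs
  refine ⟨freeSheafHomEquiv W _ (kernel.lift (redRestriction f E A) g h0), ?_⟩
  refine (freeSheafHomEquiv_comp _ _).symm.trans ?_
  refine Eq.trans ?_ hg
  exact congrArg _ (kernel.lift_ι _ _ _)

section Cech

variable {E} {U : X.Opens} (c : ChartCoordinates E U)

lemma exists_add_of_mem_nilIdeal {m : ℕ} (hm : nilradical A ^ m = ⊥) {V : (baseChange f A).Opens}
    (hVa : IsAffineOpen V) (hV : V ≤ baseChangeFst f A ⁻¹ᵁ U) (a b : Γ(baseChange f A, V))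
    (hab : (baseChange f A).basicOpen a ⊔ (baseChange f A).basicOpen b = V)
    (hD : (baseChange f A).basicOpen a ⊓ (baseChange f A).basicOpen b ≤ baseChangeFst f A ⁻¹ᵁ U)
    (j k : ℕ) (hk : 1 ≤ k) (hjk : m ≤ j + k)
    (z : E.obj.obj (op ((opensOver (baseChangeFst f A)).obj
      ((baseChange f A).basicOpen a ⊓ (baseChange f A).basicOpen b))))
    (hz : ∀ i, c.openCoord hD z i ∈ nilIdeal f A k _) :
    ∃ (x : (tildeSheaf f E A).obj.obj (op ((baseChange f A).basicOpen a)))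
      (y : (tildeSheaf f E A).obj.obj (op ((baseChange f A).basicOpen b))),
      E.obj.map ((opensOver (baseChangeFst f A)).map (homOfLE inf_le_left)).op
        (tildeInclusion f E A _ x) +
      E.obj.map ((opensOver (baseChangeFst f A)).map (homOfLE inf_le_right)).op
        (tildeInclusion f E A _ y) = z := by
  have hDa : (baseChange f A).basicOpen a ≤ baseChangeFst f A ⁻¹ᵁ U :=
    ((baseChange f A).basicOpen_le a).trans hV
  have hDb : (baseChange f A).basicOpen b ≤ baseChangeFst f A ⁻¹ᵁ U :=
    ((baseChange f A).basicOpen_le b).trans hV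
  have hDaff : IsAffineOpen ((baseChange f A).basicOpen a ⊓ (baseChange f A).basicOpen b) := by
    rw [← Scheme.basicOpen_mul]
    exact hVa.basicOpen _
  induction j generalizing k z with
  | zero =>
    have h0 : z = 0 := by
      refine c.openCoord_ext hDaff hD fun i => ?_
      have hb : nilIdeal f A k ((baseChange f A).basicOpen a ⊓ (baseChange f A).basicOpen b) ≤ ⊥ :=
        (nilIdeal_anti f A (j := m) (by omega) _).trans (by rw [nilIdeal, hm, Ideal.map_bot])
      exact ((Submodule.mem_bot _).1 (hb (hz i))).trans (c.openCoord_zero hD i).symm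
    exact ⟨0, 0, by rw [h0, map_zero, map_zero, map_zero, map_zero, add_zero]⟩
  | succ j ih =>
    have hsplit (i) := exists_add_of_basicOpen hVa a b hab (nilIdeal f A k V) (c.openCoord hD z i)
      (by rw [nilIdeal_map_homOfLE]; exact hz i)
    simp only [nilIdeal_map_homOfLE] at hsplit
    choose x hx y hy hxy using hsplit
    have hn {W : (baseChange f A).Opens} {t : Γ(W, ⊤)} (ht : t ∈ nilIdeal f A k W) :
      t ∈ nilIdeal f A 1 W := nilIdeal_anti f A hk W ht
    obtain ⟨s, hs⟩ := c.exists_openCoord hDa x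
      fun i => isNilpotent_of_mem_nilIdeal f A (hn (hx i))
    obtain ⟨t, ht⟩ := c.exists_openCoord hDb y
      fun i => isNilpotent_of_mem_nilIdeal f A (hn (hy i))
    obtain ⟨s', hs'⟩ := exists_tildeInclusion_eq f E A s
      ((c.map_redInclusion_eq_zero_iff f A (hVa.basicOpen a) hDa s).2 fun i => by
        rw [hs i]; exact hn (hx i))
    obtain ⟨t', ht'⟩ := exists_tildeInclusion_eq f E A t
      ((c.map_redInclusion_eq_zero_iff f A (hVa.basicOpen b) hDb t).2 fun i => by
        rw [ht i]; exact hn (hy i))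
    have hr : ∀ i, c.openCoord hD (z -
        (E.obj.map ((opensOver (baseChangeFst f A)).map (homOfLE inf_le_left)).op s +
          E.obj.map ((opensOver (baseChangeFst f A)).map (homOfLE inf_le_right)).op t)) i ∈
        nilIdeal f A (k + 1) _ := by
      have hs2 (i) : c.openCoord hD
          (E.obj.map ((opensOver (baseChangeFst f A)).map (homOfLE inf_le_left)).op s) i =
            ((baseChange f A).homOfLE inf_le_left).appTop (x i) :=
        (c.openCoord_map _ hDa hD s i).trans (congrArg _ (hs i))
      have ht2 (i) : c.openCoord hD
          (E.obj.map ((opensOver (baseChangeFst f A)).map (homOfLE inf_le_right)).op t) i =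
            ((baseChange f A).homOfLE inf_le_right).appTop (y i) :=
        (c.openCoord_map _ hDb hD t i).trans (congrArg _ (ht i))
      refine c.openCoord_sub_sub_mem hDaff hD (nilIdeal f A k _) (nilIdeal f A (k + 1) _)
        ?_ _ _ _ (fun i => ?_) (fun i => ?_) (fun i => ?_)
      · exact (nilIdeal_mul f A k k _).le.trans (nilIdeal_anti f A (by omega) _)
      · rw [hs2, ← nilIdeal_map_homOfLE f A k inf_le_left]
        exact Ideal.mem_map_of_mem _ (hx i)
      · rw [ht2, ← nilIdeal_map_homOfLE f A k inf_le_right]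
        exact Ideal.mem_map_of_mem _ (hy i)
      · rw [hs2, ht2, hxy, sub_self]
        exact Ideal.zero_mem _
    obtain ⟨s'', t'', h⟩ := ih (k + 1) (by omega) (by omega) _ hr
    refine ⟨s' + s'', t' + t'', ?_⟩
    rw [map_add, map_add (tildeInclusion f E A _) t', hs', ht', map_add, map_add,
      add_add_add_comm, h, add_sub_cancel]

end Cech

end DeformationCohomology

namespace DeformationCohomology

open Abelian

variable {R : Type u} [CommRing R] {X : Scheme.{u}} (f : X ⟶ Spec (.of R)) (E : BigSheaf X)
variable (A : Type u) [CommRing A] [Algebra R A] {B : Type u} [CommRing B] [Algebra R B]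

/-- The affine opens of `X_A` which lie over an open of `X` on which `E` has coordinates. -/
def chartOpens : Set (baseChange f A).Opens :=
  {V | IsAffineOpen V ∧ ∃ U : X.Opens, Nonempty (ChartCoordinates E U) ∧
    V ≤ baseChangeFst f A ⁻¹ᵁ U}

variable {E A} in
lemma exists_mem_chartOpens (hE : IsFormalLieGroup E) {W : (baseChange f A).Opens}
    {y : baseChange f A} (hy : y ∈ W) : ∃ V ∈ chartOpens f E A, V ≤ W ∧ y ∈ V := by
  obtain ⟨U, hU, hc⟩ := hE.exists_chartCoordinates (baseChangeFst f A y)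
  obtain ⟨V, hV, hyV, hVW⟩ := exists_isAffineOpen_mem_and_subset
    (U := W ⊓ baseChangeFst f A ⁻¹ᵁ U) (x := y) ⟨hy, hU⟩
  exact ⟨V, ⟨hV, U, hc, fun z hz => (hVW hz).2⟩, fun z hz => (hVW hz).1, hyV⟩

variable {A} in
lemma preimage_mem_chartOpens (φ : A →ₐ[R] B) {V : (baseChange f A).Opens}
    (hV : V ∈ chartOpens f E A) : baseChangeMap f φ ⁻¹ᵁ V ∈ chartOpens f E B := by
  obtain ⟨hVa, U, hc, hVU⟩ := hV
  exact ⟨hVa.preimage _, U, hc, preimage_le_of_comp _ (baseChangeMap_fst f φ) hVU⟩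

lemma subsingleton_ext_tildeSheaf [IsNoetherianRing A] {V : (baseChange f A).Opens}
    (hV : V ∈ chartOpens f E A) (n : ℕ) :
    Subsingleton (Ext.{u} (freeSheaf V) (tildeSheaf f E A) (n + 1)) := by
  refine subsingleton_ext_of_cech _ (chartOpens f E A) (fun V hV => hV.1) ?_ ?_ V hV n
  · rintro V ⟨hVa, U, hc, hVU⟩ a
    exact ⟨hVa.basicOpen a, U, hc, ((baseChange f A).basicOpen_le a).trans hVU⟩
  · rintro V ⟨hVa, U, ⟨c⟩, hVU⟩ a b hab z
    obtain ⟨m, hm⟩ := IsNoetherianRing.isNilpotent_nilradical A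
    have hD : (baseChange f A).basicOpen a ⊓ (baseChange f A).basicOpen b ≤
        baseChangeFst f A ⁻¹ᵁ U :=
      inf_le_left.trans (((baseChange f A).basicOpen_le a).trans hVU)
    have hDaff : IsAffineOpen ((baseChange f A).basicOpen a ⊓ (baseChange f A).basicOpen b) := by
      rw [← Scheme.basicOpen_mul]
      exact hVa.basicOpen _
    obtain ⟨x, y, h⟩ := exists_add_of_mem_nilIdeal f A c hm hVa hVU a b hab hD m 1 le_rfl
      (by omega) (tildeInclusion f E A _ z)
      ((c.map_redInclusion_eq_zero_iff f A hDaff hD _).1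
        (tildeInclusion_map_redInclusion f E A _ z))
    refine ⟨x, y, tildeInclusion_injective f E A _ ?_⟩
    rw [map_add, tildeInclusion_map, tildeInclusion_map, h]

section Comparison

variable {A}

/-- The map `Ẽ_A ⟶ π_* Ẽ_B` for `π : X_B ⟶ X_A`. -/
def tildeDirectMap (φ : A →ₐ[R] B) :
    tildeSheaf f E A ⟶ (directImage (baseChangeMap f φ)).obj (tildeSheaf f E B) :=
  (imageAdjunction (baseChangeMap f φ)).homEquiv _ _ (tildeSheafMap f E φ)

/-- A map `Ẽ_A ⟶ h_* Ẽ_B` which is given by restriction of sections of `E`. -/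
def IsRestriction {h : baseChange f B ⟶ baseChange f A}
    (w : h ≫ baseChangeFst f A = baseChangeFst f B)
    (θ : tildeSheaf f E A ⟶ (directImage h).obj (tildeSheaf f E B)) : Prop :=
  ∀ (W : (baseChange f A).Opens) (t : (tildeSheaf f E A).obj.obj (op W)),
    tildeInclusion f E B (h ⁻¹ᵁ W) (θ.hom.app (op W) t) =
      E.obj.map (preimageOver h w W).op (tildeInclusion f E A W t)

lemma isRestriction_tildeDirectMap (φ : A →ₐ[R] B) :
    IsRestriction f E (baseChangeMap_fst f φ) (tildeDirectMap f E φ) := by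
  have h : tildeDirectMap f E φ ≫ (directImage (baseChangeMap f φ)).map (tildeSheafι f E B) =
      tildeSheafι f E A ≫ restrictSmallMap E (baseChangeMap f φ) (baseChangeMap_fst f φ) := by
    rw [tildeDirectMap, ← Adjunction.homEquiv_naturality_right]
    have : tildeSheafMap f E φ ≫ tildeSheafι f E B = _ := kernel.lift_ι _ _ _
    rw [this, Equiv.apply_symm_apply]
  intro W t
  exact ConcreteCategory.congr_hom (congrArg (fun t => t.hom.app (op W)) h) t

variable {f E}

lemma IsRestriction.unique {h : baseChange f B ⟶ baseChange f A}
    {w : h ≫ baseChangeFst f A = baseChangeFst f B}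
    {θ θ' : tildeSheaf f E A ⟶ (directImage h).obj (tildeSheaf f E B)}
    (hθ : IsRestriction f E w θ) (hθ' : IsRestriction f E w θ') : θ = θ' := by
  apply Sheaf.hom_ext
  ext W t
  exact tildeInclusion_injective f E B _ ((hθ W.unop t).trans (hθ' W.unop t).symm)

lemma preimageOver_comp {Y Y' Y'' : Scheme.{u}} {p : Y ⟶ X} {p' : Y' ⟶ X} {p'' : Y'' ⟶ X}
    (h : Y' ⟶ Y) (w : h ≫ p = p') (h' : Y'' ⟶ Y') (w' : h' ≫ p' = p'') (w'' : (h' ≫ h) ≫ p = p'')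
    (W : Y.Opens) :
    preimageOver (h' ≫ h) w'' W = preimageOver h' w' (h ⁻¹ᵁ W) ≫ preimageOver h w W := by
  ext1
  exact morphismRestrict_comp h' h W

variable {C : Type u} [CommRing C] [Algebra R C]

lemma IsRestriction.comp {h : baseChange f B ⟶ baseChange f A}
    {w : h ≫ baseChangeFst f A = baseChangeFst f B}
    {θ : tildeSheaf f E A ⟶ (directImage h).obj (tildeSheaf f E B)} (hθ : IsRestriction f E w θ)
    {h' : baseChange f C ⟶ baseChange f B} {w' : h' ≫ baseChangeFst f B = baseChangeFst f C}
    {θ' : tildeSheaf f E B ⟶ (directImage h').obj (tildeSheaf f E C)}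
    (hθ' : IsRestriction f E w' θ') (w'' : (h' ≫ h) ≫ baseChangeFst f A = baseChangeFst f C) :
    IsRestriction f E w'' (θ ≫ (directImage h).map θ') := by
  intro W t
  have e (y : E.obj.obj (op ((opensOver (baseChangeFst f A)).obj W))) :
      E.obj.map (preimageOver (h' ≫ h) w'' W).op y = E.obj.map (preimageOver h' w' (h ⁻¹ᵁ W)).op
        (E.obj.map (preimageOver h w W).op y) := by
    rw [preimageOver_comp h w h' w']
    exact ConcreteCategory.congr_hom
      (E.obj.map_comp (preimageOver h w W).op (preimageOver h' w' (h ⁻¹ᵁ W)).op) y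
  refine (hθ' (h ⁻¹ᵁ W) (θ.hom.app (op W) t)).trans ?_
  rw [hθ W t]
  exact (e _).symm

lemma IsRestriction.cohomologyMap_eq {h h' : baseChange f B ⟶ baseChange f A} (hh : h = h')
    {w : h ≫ baseChangeFst f A = baseChangeFst f B}
    {θ : tildeSheaf f E A ⟶ (directImage h).obj (tildeSheaf f E B)} (hθ : IsRestriction f E w θ)
    {w' : h' ≫ baseChangeFst f A = baseChangeFst f B}
    {θ' : tildeSheaf f E A ⟶ (directImage h').obj (tildeSheaf f E B)}
    (hθ' : IsRestriction f E w' θ') (q : ℕ) :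
    cohomologyMap h (((imageAdjunction h).homEquiv _ _).symm θ) q =
      cohomologyMap h' (((imageAdjunction h').homEquiv _ _).symm θ') q := by
  subst hh
  rw [hθ.unique hθ']

variable (f E)

lemma deformationHMap_eq (φ : A →ₐ[R] B) (q : ℕ) : deformationHMap f E φ q =
    cohomologyMap (baseChangeMap f φ)
      (((imageAdjunction (baseChangeMap f φ)).homEquiv _ _).symm (tildeDirectMap f E φ)) q := by
  rw [deformationHMap, tildeDirectMap, Equiv.symm_apply_apply]

lemma deformationHMap_comp (φ : A →ₐ[R] B) (ψ : B →ₐ[R] C) (q : ℕ) :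
    (deformationHMap f E ψ q).comp (deformationHMap f E φ q) =
      deformationHMap f E (ψ.comp φ) q := by
  ext x
  rw [AddMonoidHom.comp_apply, deformationHMap_eq, deformationHMap_eq, deformationHMap_eq]
  refine (cohomologyMap_comp _ _ _ _ q x).trans ?_
  have w : (baseChangeMap f ψ ≫ baseChangeMap f φ) ≫ baseChangeFst f A = baseChangeFst f C := by
    rw [baseChangeMap_comp, baseChangeMap_fst]
  rw [((isRestriction_tildeDirectMap f E φ).comp (isRestriction_tildeDirectMap f E ψ)
    w).cohomologyMap_eq (baseChangeMap_comp f φ ψ) (isRestriction_tildeDirectMap f E (ψ.comp φ)) q]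

end Comparison

section NilHull

lemma NilHull.toAlgebra_mk (w : Unitization R (nilradical A)) :
    NilHull.toAlgebra R A (Ideal.Quotient.mk _ w) = algebraMap R A w.fst + w.snd := rfl

lemma NilHull.eq_zero_of_toAlgebra_eq_zero {x : NilHull R A} (hx : x ∈ nilradical (NilHull R A))
    (h : NilHull.toAlgebra R A x = 0) : x = 0 := by
  obtain ⟨w, rfl⟩ := Ideal.Quotient.mk_surjective x
  obtain ⟨n, hn⟩ := mem_nilradical.1 hx
  rw [← map_pow, Ideal.Quotient.eq_zero_iff_mem] at hn
  rw [Ideal.Quotient.eq_zero_iff_mem]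
  rw [NilHull.toAlgebra_mk] at h
  refine ⟨?_, (neg_eq_of_add_eq_zero_right h).symm⟩
  have h1 : (w ^ n).fst = w.fst ^ n := map_pow (Unitization.fstHom R (nilradical A)) w n
  have h2 : w.fst ^ n ∈ nilradical R := h1 ▸ hn.1
  exact IsNilpotent.of_pow h2

lemma NilHull.exists_toAlgebra_eq {a : A} (ha : a ∈ nilradical A) :
    ∃ x ∈ nilradical (NilHull R A), NilHull.toAlgebra R A x = a := by
  let w : Unitization R (nilradical A) := Unitization.inr ⟨a, ha⟩
  refine ⟨Ideal.Quotient.mk _ w, ?_, by simp [NilHull.toAlgebra_mk, w]⟩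
  obtain ⟨n, hn⟩ := mem_nilradical.1 ha
  refine mem_nilradical.2 ⟨n + 1, ?_⟩
  rw [← map_pow, Ideal.Quotient.eq_zero_iff_mem]
  have h1 : (w ^ (n + 1)).fst = 0 := by
    have : (w ^ (n + 1)).fst = w.fst ^ (n + 1) :=
      map_pow (Unitization.fstHom R (nilradical A)) w (n + 1)
    rw [this]
    simp [w]
  refine ⟨h1 ▸ Ideal.zero_mem _, ?_⟩
  have h2 : algebraMap R A (w ^ (n + 1)).fst + (w ^ (n + 1)).snd = a ^ (n + 1) := by
    rw [← NilHull.toAlgebra_mk, map_pow, map_pow, NilHull.toAlgebra_mk]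
    simp [w]
  rw [h1, map_zero, zero_add, pow_succ a, hn, zero_mul] at h2
  rw [h1, h2, map_zero, neg_zero]

lemma NilHull.toAlgebra_comp_map {A B : Type u} [CommRing A] [Algebra R A] [CommRing B]
    [Algebra R B] (φ : A →ₐ[R] B) :
    (NilHull.toAlgebra R B).comp (NilHull.map φ) = φ.comp (NilHull.toAlgebra R A) := by
  apply AlgHom.ext
  intro x
  obtain ⟨w, rfl⟩ := Ideal.Quotient.mk_surjective x
  change NilHull.toAlgebra R B (Ideal.Quotient.mk _ (Unitization.lift
    ((Unitization.inrNonUnitalAlgHom R (nilradical B)).comp (nilMap φ)) w)) =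
      φ (NilHull.toAlgebra R A (Ideal.Quotient.mk _ w))
  rw [NilHull.toAlgebra_mk, NilHull.toAlgebra_mk]
  simp [nilMap, Unitization.algebraMap_eq_inl]

end NilHull

section Iso

lemma isIso_of_bijective_basis {Y : Scheme.{u}} {F G : SmallSheaf Y} (g : F ⟶ G)
    (hg : ∀ (U : Y.Opens) (y : Y), y ∈ U → ∃ V ≤ U, y ∈ V ∧
      Function.Bijective (g.hom.app (op V))) : IsIso g := by
  have : Epi g := epi_of_surjective_basis g fun U y hy =>
    let ⟨V, hVU, hyV, h⟩ := hg U y hy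
    ⟨V, hVU, hyV, h.2⟩
  have hinj (U : Y.Opens) : Function.Injective (g.hom.app (op U)) := by
    intro s t hst
    choose V hVU hyV hV using fun y : U => hg U y.1 y.2
    refine TopCat.Sheaf.eq_of_locally_eq' (X := Y.toTopCat) F V U (fun y => homOfLE (hVU y))
      (fun y hy => Opens.mem_iSup.2 ⟨⟨y, hy⟩, hyV ⟨y, hy⟩⟩) s t fun y => (hV y).1 ?_
    have hn := g.hom.naturality (homOfLE (hVU y)).op
    refine (ConcreteCategory.congr_hom hn s).trans
      (Eq.trans ?_ (ConcreteCategory.congr_hom hn t).symm)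
    exact congrArg (G.obj.map (homOfLE (hVU y)).op) hst
  have : Mono g := by
    have (U : Y.Opensᵒᵖ) : Mono (g.hom.app U) :=
      (AddCommGrpCat.mono_iff_injective _).2 (hinj U.unop)
    have : Mono g.hom := NatTrans.mono_of_mono_app _
    exact Sheaf.Hom.mono_of_presheaf_mono _ _ g
  exact isIso_of_mono_of_epi g

variable {E} in
lemma tildeDirectMap_nilHull_bijective [Flat f] {W : (baseChange f (NilHull R A)).Opens}
    (hW : W ∈ chartOpens f E (NilHull R A)) :
    Function.Bijective ((tildeDirectMap f E (NilHull.toAlgebra R A)).hom.app (op W)) := by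
  obtain ⟨hWa, U, ⟨c⟩, hWU⟩ := hW
  let g := baseChangeMap f (NilHull.toAlgebra R A)
  have hres := isRestriction_tildeDirectMap f E (NilHull.toAlgebra R A) W
  have hWa' : IsAffineOpen (g ⁻¹ᵁ W) := hWa.preimage g
  have hWU' : g ⁻¹ᵁ W ≤ _ := preimage_le_of_comp g (baseChangeMap_fst f _) hWU
  have hcoord := c.openCoord_preimageOver g (baseChangeMap_fst f _) hWU hWU'
  obtain ⟨hinj, hsurj⟩ := nilIdeal_bijective f (NilHull.toAlgebra R A)
    (fun n hn h => NilHull.eq_zero_of_toAlgebra_eq_zero A hn h)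
    (fun a ha => NilHull.exists_toAlgebra_eq A ha) hWa
  constructor
  · refine (injective_iff_map_eq_zero
      ((tildeDirectMap f E (NilHull.toAlgebra R A)).hom.app (op W)).hom).2 fun t ht => ?_
    have h0 : E.obj.map (preimageOver g (baseChangeMap_fst f _) W).op
        (tildeInclusion f E (NilHull R A) W t) = 0 := by
      rw [← hres t]
      exact (congrArg _ ht).trans (map_zero _)
    have hmem := (c.map_redInclusion_eq_zero_iff f _ hWa hWU _).1
      (tildeInclusion_map_redInclusion f E (NilHull R A) W t)
    apply tildeInclusion_injective f E (NilHull R A) W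
    rw [map_zero]
    refine c.openCoord_ext hWa hWU fun i => ?_
    rw [c.openCoord_zero]
    refine hinj _ (hmem i) ?_
    refine (hcoord _ i).symm.trans ?_
    rw [h0, c.openCoord_zero]
  · intro u
    have hmem := (c.map_redInclusion_eq_zero_iff f A hWa' hWU' _).1
      (tildeInclusion_map_redInclusion f E A (g ⁻¹ᵁ W) u)
    choose x hx hxu using fun i => hsurj _ (hmem i)
    obtain ⟨s, hs⟩ := c.exists_openCoord hWU x fun i =>
      isNilpotent_of_mem_nilIdeal f (NilHull R A) (hx i)
    obtain ⟨t, ht⟩ := exists_tildeInclusion_eq f E (NilHull R A) s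
      ((c.map_redInclusion_eq_zero_iff f _ hWa hWU _).2 fun i => by
        rw [hs i]; exact hx i)
    refine ⟨t, tildeInclusion_injective f E A (g ⁻¹ᵁ W) ?_⟩
    refine (hres t).trans (c.openCoord_ext hWa' hWU' fun i => ?_)
    refine (hcoord _ i).trans ?_
    rw [ht, hs]
    exact hxu i

variable {E} in
theorem nilHullComparison_bijective [Flat f] (hE : IsFormalLieGroup E) [IsNoetherianRing A]
    (q : ℕ) : Function.Bijective (nilHullComparison f E A q) := by
  rw [nilHullComparison, deformationHMap_eq]
  have : IsIso (tildeDirectMap f E (NilHull.toAlgebra R A)) :=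
    isIso_of_bijective_basis _ fun U y hy =>
      let ⟨V, hV, hVU, hyV⟩ := exists_mem_chartOpens f hE hy
      ⟨V, hVU, hyV, tildeDirectMap_nilHull_bijective f A hV⟩
  refine cohomologyMap_bijective _ _ (fun U y hy => ?_) q
  obtain ⟨V, hV, hVU, hyV⟩ := exists_mem_chartOpens f hE hy
  exact ⟨V, hVU, hyV, fun n =>
    subsingleton_ext_tildeSheaf f E A (preimage_mem_chartOpens f E _ hV) n⟩

end Iso

end DeformationCohomology

end

theorem proposition2p2p1 {R : Type u} [CommRing R] [IsNoetherianRing R]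
    {X : Scheme.{u}} [IsNoetherian X] (f : X ⟶ Spec (.of R)) [Flat f]
    (E : BigSheaf X) (hE : IsFormalLieGroup E) (q : ℕ) :
    (∀ (A : Type u) [CommRing A] [Algebra R A] [IsNoetherianRing A],
      Function.Bijective (nilHullComparison f E A q)) ∧
    (∀ (A B : Type u) [CommRing A] [Algebra R A] [IsNoetherianRing A]
      [CommRing B] [Algebra R B] [IsNoetherianRing B] (φ : A →ₐ[R] B),
      (deformationHMap f E φ q).comp (nilHullComparison f E A q) =
        (nilHullComparison f E B q).comp (deformationHMap f E (NilHull.map φ) q)) := by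
  refine ⟨fun A _ _ _ => nilHullComparison_bijective f A hE q, fun A B _ _ _ _ _ _ φ => ?_⟩
  rw [nilHullComparison, nilHullComparison, deformationHMap_comp, deformationHMap_comp,
    NilHull.toAlgebra_comp_map]
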